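/- Let $D=\{z\in\mathbb C:|z|<1\}$ and let $H(D)$ be the space of analytic functions on $D$. For $\alpha>0$ let $v_\alpha(z)=(1-|z|^2)^\alpha$, $\|f\|_{v_\alpha}=\sup_{z\in D}v_\alpha(z)|f(z)|$, and let $\mathcal Z^\alpha$ be the space of all $f\in H(D)$ with $\|f''\|_{v_\alpha}<\infty$, normed by $\|f\|_{\mathcal Z^\alpha}=|f(0)|+|f'(0)|+\|f''\|_{v_\alpha}$. For an analytic map $\varphi:D\to D$ and $g\in H(D)$ put $$(C_\varphi V_g f)(z)=\int_0^{\varphi(z)}f'(\xi)g(\xi)\,d\xi .$$ For a bounded linear operator $T:X\to Y$ between normed spaces let $\|T\|_{e,X\to Y}=\inf\{\|T+K\|_{X\to Y}:K:X\to Y\text{ a compact linear operator}\}$. **Theorem.** Let $\alpha,\beta>0$. There are constants $C_1,C_2>0$, depending only on $\alpha$ and $\beta$, such that for every analytic $\varphi:D\to D$ and every $g\in H(D)$ for which $C_\varphi V_g$ is a bounded operator from $\mathcal Z^\alpha$ to $\mathcal Z^\beta$, $$C_1\,\|C_\varphi V_g\|_{e,\mathcal Z^\alpha\to\mathcal Z^\beta}\le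 R\le C_2\,\|C_\varphi V_g\|_{e,\mathcal Z^\alpha\to\mathcal Z^\beta},$$ where (i) if $0<\alpha<1$, then $$R=\limsup_{n\to\infty}(n+1)^\alpha\|(g\circ\varphi)(\varphi')^2\varphi^n\|_{v_\beta};$$ (ii) if $\alpha=1$, then $$R=\max\Big\{\limsup_{n\to\infty}(n+1)\|(g\circ\varphi)(\varphi')^2\varphi^n\|_{v_\beta},\ \limsup_{n\to\infty}(\log n)\|((g'\circ\varphi)(\varphi')^2+(g\circ\varphi)\varphi'')\varphi^n\|_{v_\beta}\Big\};$$ (iii) if $\alpha>1$, then $$R=\max\Big\{\limsup_{n\to\infty}(n+1)^\alpha\|(g\circ\varphi)(\varphi')^2\varphi^n\|_{v_\beta},\ \limsup_{n\to\infty}(n+1)^{\alpha-1}\|((g'\circ\varphi)(\varphi')^2+(g\circ\varphi)\varphi'')\varphi^n\|_{v_\beta}\Big\}.$$ Here $\varphi^n$ denotes the $n$-th power of $\varphi$. -/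

import Mathlib

open scoped ENNReal NNReal

noncomputable section

/-- The open unit disk `D` of the complex plane. -/
abbrev unitDisk : Set ℂ := Metric.ball (0 : ℂ) 1

/-- The standard weight `v_α(z) = (1 - |z|²)^α`. -/
def stdWeight (α : ℝ) (z : ℂ) : ℝ := (1 - ‖z‖ ^ 2) ^ α

/-- The norm `‖f‖_{v_β} = sup_{z ∈ D} v_β(z) |f(z)|`, with value `∞` when the supremum is infinite. -/
def weightedNorm (β : ℝ) (f : ℂ → ℂ) : ℝ≥0∞ :=
  ⨆ z ∈ unitDisk, ENNReal.ofReal (stdWeight β z * ‖f z‖)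

lemma stdWeight_nonneg (α : ℝ) {z : ℂ} (hz : z ∈ unitDisk) : 0 ≤ stdWeight α z := by
  have h : ‖z‖ < 1 := by simpa using hz
  exact Real.rpow_nonneg (by nlinarith [norm_nonneg z]) α

lemma stdWeight_pos (α : ℝ) {z : ℂ} (hz : z ∈ unitDisk) : 0 < stdWeight α z := by
  have h : ‖z‖ < 1 := by simpa using hz
  exact Real.rpow_pos_of_pos (by nlinarith [norm_nonneg z]) α

lemma deriv_add_unitDisk {f g : ℂ → ℂ} (hf : DifferentiableOn ℂ f unitDisk)
    (hg : DifferentiableOn ℂ g unitDisk) :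
    Set.EqOn (deriv (f + g)) (deriv f + deriv g) unitDisk := fun _ hz =>
  deriv_add (hf.differentiableAt (Metric.isOpen_ball.mem_nhds hz))
    (hg.differentiableAt (Metric.isOpen_ball.mem_nhds hz))

lemma deriv_deriv_add_unitDisk {f g : ℂ → ℂ} (hf : DifferentiableOn ℂ f unitDisk)
    (hg : DifferentiableOn ℂ g unitDisk) :
    Set.EqOn (deriv (deriv (f + g))) (deriv (deriv f) + deriv (deriv g)) unitDisk := fun _ hz =>
  ((deriv_add_unitDisk hf hg).deriv Metric.isOpen_ball hz).trans
    (deriv_add_unitDisk (hf.deriv Metric.isOpen_ball) (hg.deriv Metric.isOpen_ball) hz)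

lemma deriv_smul_fun (c : ℂ) (f : ℂ → ℂ) : deriv (c • f) = c • deriv f := by
  funext z
  simp [deriv_const_smul_field]

/-- The functions of the Zygmund type space `𝒵^α`: analytic on `D` with
`sup_{z ∈ D} (1 - |z|²)^α |f''(z)| < ∞`. A function on `D` is represented by its extension by `0`
to `ℂ`, so that two members are equal exactly when they agree on `D`; derivatives at points of the
open set `D` do not see the extension. -/
def zygmundSubmodule (α : ℝ) : Submodule ℂ (ℂ → ℂ) where
  carrier := {f | DifferentiableOn ℂ f unitDisk ∧ (∀ z ∉ unitDisk, f z = 0) ∧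
    ∃ C : ℝ, ∀ z ∈ unitDisk, stdWeight α z * ‖deriv (deriv f) z‖ ≤ C}
  zero_mem' := by
    refine ⟨differentiableOn_const 0, fun _ _ => rfl, 0, fun z _ => ?_⟩
    simp
  add_mem' := by
    rintro f g ⟨hf, hf0, C, hC⟩ ⟨hg, hg0, C', hC'⟩
    refine ⟨hf.add hg, fun z hz => by simp [hf0 z hz, hg0 z hz], C + C', fun z hz => ?_⟩
    rw [deriv_deriv_add_unitDisk hf hg hz, Pi.add_apply]
    calc stdWeight α z * ‖deriv (deriv f) z + deriv (deriv g) z‖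
        ≤ stdWeight α z * (‖deriv (deriv f) z‖ + ‖deriv (deriv g) z‖) :=
          mul_le_mul_of_nonneg_left (norm_add_le _ _) (stdWeight_nonneg α hz)
      _ ≤ C + C' := by rw [mul_add]; exact add_le_add (hC z hz) (hC' z hz)
  smul_mem' := by
    rintro c f ⟨hf, hf0, C, hC⟩
    refine ⟨hf.const_smul c, fun z hz => by simp [hf0 z hz], ‖c‖ * C, fun z hz => ?_⟩
    rw [deriv_smul_fun, deriv_smul_fun, Pi.smul_apply, norm_smul, mul_left_comm]
    exact mul_le_mul_of_nonneg_left (hC z hz) (norm_nonneg c)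

/-- The Zygmund type space `𝒵^α`, as a type of its own (its topology is that of the norm below and
not the one of pointwise convergence). -/
def ZygmundSpace (α : ℝ) : Type := ↥(zygmundSubmodule α)

namespace ZygmundSpace

variable {α : ℝ}

instance : AddCommGroup (ZygmundSpace α) := inferInstanceAs (AddCommGroup ↥(zygmundSubmodule α))

instance : Module ℂ (ZygmundSpace α) := inferInstanceAs (Module ℂ ↥(zygmundSubmodule α))

instance : CoeFun (ZygmundSpace α) (fun _ => ℂ → ℂ) := ⟨fun f => f.1⟩

/-- `‖f‖_{𝒵^α} = |f(0)| + |f'(0)| + sup_{z ∈ D} (1 - |z|²)^α |f''(z)|`. -/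
instance : Norm (ZygmundSpace α) :=
  ⟨fun f => ‖f 0‖ + ‖deriv f 0‖ + ⨆ z : unitDisk, stdWeight α z * ‖deriv (deriv f) z‖⟩

lemma norm_def (f : ZygmundSpace α) :
    ‖f‖ = ‖f 0‖ + ‖deriv f 0‖ + ⨆ z : unitDisk, stdWeight α z * ‖deriv (deriv f) z‖ := rfl

lemma coe_add (f g : ZygmundSpace α) : (⇑(f + g) : ℂ → ℂ) = f + g := rfl

lemma coe_smul (c : ℂ) (f : ZygmundSpace α) : (⇑(c • f) : ℂ → ℂ) = c • (f : ℂ → ℂ) := rfl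

lemma coe_zero : (⇑(0 : ZygmundSpace α) : ℂ → ℂ) = 0 := rfl

lemma differentiableOn (f : ZygmundSpace α) : DifferentiableOn ℂ f unitDisk := f.2.1

lemma bddAbove (f : ZygmundSpace α) :
    BddAbove (Set.range fun z : unitDisk => stdWeight α z * ‖deriv (deriv f) z‖) := by
  obtain ⟨C, hC⟩ := f.2.2.2
  exact ⟨C, by rintro _ ⟨z, rfl⟩; exact hC z z.2⟩

lemma iSup_nonneg (f : ZygmundSpace α) :
    0 ≤ ⨆ z : unitDisk, stdWeight α z * ‖deriv (deriv f) z‖ :=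
  Real.iSup_nonneg fun z => mul_nonneg (stdWeight_nonneg α z.2) (norm_nonneg _)

lemma zero_mem_unitDisk : (0 : ℂ) ∈ unitDisk := by simp

lemma eq_zero_of_norm_eq_zero (f : ZygmundSpace α) (h : ‖f‖ = 0) : f = 0 := by
  rw [norm_def] at h
  have h0 := norm_nonneg (f 0)
  have h1 := norm_nonneg (deriv f 0)
  have h2 := f.iSup_nonneg
  have hf0 : f 0 = 0 := norm_eq_zero.1 (by linarith)
  have hf1 : deriv f 0 = 0 := norm_eq_zero.1 (by linarith)
  have hs : ⨆ z : unitDisk, stdWeight α z * ‖deriv (deriv f) z‖ = 0 := by linarith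
  have hf2 : ∀ z ∈ unitDisk, deriv (deriv f) z = 0 := fun z hz => by
    have h3 : stdWeight α z * ‖deriv (deriv f) z‖ ≤ 0 := hs ▸ le_ciSup f.bddAbove ⟨z, hz⟩
    have h4 := stdWeight_pos α hz
    exact norm_eq_zero.1 (le_antisymm (by nlinarith) (norm_nonneg _))
  have hpre : IsPreconnected unitDisk := (convex_ball (0 : ℂ) 1).isPreconnected
  have hf1' : ∀ z ∈ unitDisk, deriv f z = 0 := fun z hz =>
    (Metric.isOpen_ball.is_const_of_deriv_eq_zero hpre
      (f.differentiableOn.deriv Metric.isOpen_ball) hf2 hz zero_mem_unitDisk).trans hf1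
  have hf' : ∀ z ∈ unitDisk, f z = 0 := fun z hz =>
    (Metric.isOpen_ball.is_const_of_deriv_eq_zero hpre
      f.differentiableOn hf1' hz zero_mem_unitDisk).trans hf0
  refine Subtype.ext (funext fun z => ?_)
  by_cases hz : z ∈ unitDisk
  · exact hf' z hz
  · exact f.2.2.1 z hz

lemma core : NormedSpace.Core ℂ (ZygmundSpace α) where
  norm_nonneg f := add_nonneg (add_nonneg (norm_nonneg _) (norm_nonneg _)) f.iSup_nonneg
  norm_smul c f := by
    simp only [norm_def, coe_smul, deriv_smul_fun, Pi.smul_apply, norm_smul, mul_add]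
    congr 1
    rw [Real.mul_iSup_of_nonneg (norm_nonneg c)]
    exact iSup_congr fun z => mul_left_comm _ _ _
  norm_triangle f g := by
    have hsup : ⨆ z : unitDisk, stdWeight α z * ‖deriv (deriv (f + g : ZygmundSpace α)) z‖ ≤
        (⨆ z : unitDisk, stdWeight α z * ‖deriv (deriv f) z‖) +
          ⨆ z : unitDisk, stdWeight α z * ‖deriv (deriv g) z‖ := by
      have : Nonempty unitDisk := ⟨⟨0, zero_mem_unitDisk⟩⟩
      refine ciSup_le fun z => ?_
      rw [coe_add, deriv_deriv_add_unitDisk f.differentiableOn g.differentiableOn z.2,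
        Pi.add_apply]
      calc stdWeight α z * ‖deriv (deriv f) z + deriv (deriv g) z‖
          ≤ stdWeight α z * (‖deriv (deriv f) z‖ + ‖deriv (deriv g) z‖) :=
            mul_le_mul_of_nonneg_left (norm_add_le _ _) (stdWeight_nonneg α z.2)
        _ ≤ _ := by
            rw [mul_add]
            exact add_le_add (le_ciSup f.bddAbove z) (le_ciSup g.bddAbove z)
    have h0 : ‖(f + g : ZygmundSpace α) 0‖ ≤ ‖f 0‖ + ‖g 0‖ := norm_add_le _ _
    have h1 : ‖deriv (f + g : ZygmundSpace α) 0‖ ≤ ‖deriv f 0‖ + ‖deriv g 0‖ := by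
      rw [coe_add, deriv_add_unitDisk f.differentiableOn g.differentiableOn zero_mem_unitDisk]
      exact norm_add_le _ _
    rw [norm_def (f + g), norm_def f, norm_def g]
    linarith
  norm_eq_zero_iff f := by
    refine ⟨eq_zero_of_norm_eq_zero f, ?_⟩
    rintro rfl
    have h : deriv (0 : ℂ → ℂ) = 0 := by funext z; simp
    simp [norm_def, coe_zero, h]

instance : NormedAddCommGroup (ZygmundSpace α) := NormedAddCommGroup.ofCore core

instance : NormedSpace ℂ (ZygmundSpace α) := NormedSpace.ofCore core

end ZygmundSpace

/-- The Volterra-type operator `(V_g f)(z) = ∫_0^z f'(ξ) g(ξ) dξ`, integrated along the segment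
`ξ = t z`, `0 ≤ t ≤ 1`. -/
def volterraV (g f : ℂ → ℂ) (z : ℂ) : ℂ :=
  ∫ t in (0 : ℝ)..1, deriv f (t * z) * g (t * z) * z

/-- The operator `C_φ V_g`, that is `(C_φ V_g f)(z) = ∫_0^{φ(z)} f'(ξ) g(ξ) dξ`. -/
def compVolterraV (φ g f : ℂ → ℂ) (z : ℂ) : ℂ := volterraV g f (φ z)

/-- The essential norm of a bounded operator: its distance to the compact operators,
`‖T‖_e = inf {‖T + K‖ : K compact}` (always finite). -/
def essentialNorm {X Y : Type*} [NormedAddCommGroup X] [NormedSpace ℂ X]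
    [NormedAddCommGroup Y] [NormedSpace ℂ Y] (T : X →L[ℂ] Y) : ℝ≥0∞ :=
  ⨅ (K : X →L[ℂ] Y) (_ : IsCompactOperator K), ‖T + K‖ₑ

/-- `a ≍ b` with the constants `C₁`, `C₂`. -/
def ComparableWith (C₁ C₂ : ℝ≥0) (a b : ℝ≥0∞) : Prop := C₁ * a ≤ b ∧ b ≤ C₂ * a

/-- `limsup_{n → ∞} c_n ‖u φ^n‖_{v_β}`. -/
def limsupPow (β : ℝ) (c : ℕ → ℝ≥0∞) (u φ : ℂ → ℂ) : ℝ≥0∞ :=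
  Filter.limsup (fun n : ℕ => c n * weightedNorm β (fun z => u z * φ z ^ n)) Filter.atTop

end

noncomputable section

open ComplexConjugate

/-! Write `T` for the operator, `u` for `symbolTwo` and `w` for `symbolOne`. Then `(T f)'' = (f'' ∘
φ) u + (f' ∘ φ) w`, so everything is decided by how large the weighted symbols are where `|φ|` is
near `1`. At such points `f''` can be of size `(1 - |φ|)^(-α)`. The size of `f'` is bounded for `α <
1`, logarithmic for `α = 1`, and of order `(1 - |φ|)^(1 - α)` for `α > 1`. Up to constants, the
limsups in `R` measure `u` and `w` against these rates, because `sup_n (n + 1)^p r^n` is comparable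
to `(1 - r)^(-p)`, with `n ≈ 1 / (1 - r)` nearly optimal; the same `n` works for `log n` against
`-log (1 - r)` (`limsupPow_le`, `exists_boundary_bound_of_limsupPow_lt`).

The essential norm is at most a multiple of `R`: finite rank operators `P`, built from truncated
Taylor series of dilates, make `f - P f` uniformly small on compact sets while keeping its weighted
second derivative at most `3 ‖f‖` (`exists_isCompactOperator_close`). In `T - T P` only the region
where `|φ|` is near `1` survives, and there the growth rates apply
(`essentialNorm_le_of_boundary_bound`). For `α < 1` the `w`-term is negligible, since `f'` changes
little near the circle.

`R` is at most a multiple of the essential norm: explicit test functions concentrated at `a`, with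
`a = φ z` near the circle, are bounded and tend to `0` locally uniformly, so a compact `K` sends
them to `0` and `T + K` acts on them almost as `T`. A combination with `f'(a) = 0` isolates `u`; a
family with `f'(a)` as large as possible then bounds `w`. That `K` sends them to `0` is shown
without identifying the dual space: the functions are almost disjoint, so sums of many of them stay
nearly bounded, whereas a nonzero limit of their images would make the images of the sums grow
linearly (`IsCompactOperator.tendsto_zero_of_disjoint`). -/

lemma norm_lt_one_of_mem {z : ℂ} (hz : z ∈ unitDisk) : ‖z‖ < 1 := by simpa using hz

lemma mem_unitDisk_of_norm_lt {z : ℂ} (hz : ‖z‖ < 1) : z ∈ unitDisk := by simpa using hz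

lemma unitDisk_mem_nhds {z : ℂ} (hz : z ∈ unitDisk) : unitDisk ∈ nhds z :=
  Metric.isOpen_ball.mem_nhds hz

/-! ### Radial growth from a weighted bound on the derivative. -/

lemma one_sub_rpow_le_stdWeight {α : ℝ} (hα : 0 < α) {z : ℂ} (hz : z ∈ unitDisk) :
    (1 - ‖z‖) ^ α ≤ stdWeight α z := by
  have h := norm_lt_one_of_mem hz
  have h0 := norm_nonneg z
  exact Real.rpow_le_rpow (by linarith) (by nlinarith) hα.le

lemma stdWeight_le_rpow_of_le {α : ℝ} (hα : 0 < α) {z : ℂ} (hz : z ∈ unitDisk) {x : ℝ}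
    (hx : 1 - ‖z‖ ^ 2 ≤ x) : stdWeight α z ≤ x ^ α := by
  have h := norm_lt_one_of_mem hz
  have h0 := norm_nonneg z
  exact Real.rpow_le_rpow (by nlinarith) hx hα.le

lemma norm_le_rpow_of_stdWeight_mul_le {α M : ℝ} (hα : 0 < α) {z x : ℂ} (hz : z ∈ unitDisk)
    (h : stdWeight α z * ‖x‖ ≤ M) : ‖x‖ ≤ M * (1 - ‖z‖) ^ (-α) := by
  have h1 : 0 < 1 - ‖z‖ := by linarith [norm_lt_one_of_mem hz]
  have h2 : (1 - ‖z‖) ^ α * ‖x‖ ≤ M :=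
    (mul_le_mul_of_nonneg_right (one_sub_rpow_le_stdWeight hα hz) (norm_nonneg x)).trans h
  rw [Real.rpow_neg h1.le, ← div_eq_mul_inv, le_div_iff₀ (Real.rpow_pos_of_pos h1 α)]
  linarith

/-- Integrate `F'` along the ray through `z`, starting at radius `s`; `B` is a primitive of the
radial majorant. A positive starting radius matters only for `α < 1`, where the part of the ray near
the circle has to be small by itself. -/
lemma exists_norm_le_add_of_norm_deriv_le {F : ℂ → ℂ} (hF : DifferentiableOn ℂ F unitDisk)
    {B B' : ℝ → ℝ} {s : ℝ} (hs : 0 ≤ s) (hB : ∀ t ∈ Set.Ico s 1, HasDerivAt B (B' t) t)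
    (hF' : ∀ z ∈ unitDisk, s ≤ ‖z‖ → ‖deriv F z‖ ≤ B' ‖z‖) {z : ℂ} (hz : z ∈ unitDisk)
    (hsz : s ≤ ‖z‖) : ∃ ζ : ℂ, ‖ζ‖ = s ∧ ‖F z‖ ≤ ‖F ζ‖ + (B ‖z‖ - B s) := by
  obtain ⟨ω, hω, hzω⟩ : ∃ ω : ℂ, ‖ω‖ = 1 ∧ (‖z‖ : ℂ) * ω = z := by
    by_cases h : z = 0
    · exact ⟨1, by simp, by simp [h]⟩
    · have h' : (‖z‖ : ℂ) ≠ 0 := by simpa using h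
      exact ⟨z / ‖z‖, by simp [h], by field_simp⟩
  have hz1 := norm_lt_one_of_mem hz
  have hn : ∀ t : ℝ, 0 ≤ t → ‖(t : ℂ) * ω‖ = t := fun t ht => by
    rw [norm_mul, hω, mul_one, Complex.norm_real, Real.norm_of_nonneg ht]
  have hD : ∀ t ∈ Set.Icc s ‖z‖, HasDerivAt (fun t : ℝ => F (t * ω))
      (deriv F (t * ω) * ω) t := fun t ht => by
    have hm : (t : ℂ) * ω ∈ unitDisk :=
      mem_unitDisk_of_norm_lt (by rw [hn t (hs.trans ht.1)]; linarith [ht.2])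
    have h1 := (hF.differentiableAt (unitDisk_mem_nhds hm)).hasDerivAt
    have h2 : HasDerivAt (fun t : ℝ => (t : ℂ) * ω) (1 * ω) t :=
      (Complex.ofRealCLM.hasDerivAt (x := t)).mul_const ω
    rw [one_mul] at h2
    exact HasDerivAt.comp t h1 h2
  have key := image_norm_le_of_norm_deriv_right_le_deriv_boundary'
    (f := fun t : ℝ => F (t * ω)) (f' := fun t : ℝ => deriv F (t * ω) * ω) (a := s) (b := ‖z‖)
    (fun t ht => (hD t ht).continuousAt.continuousWithinAt)
    (fun t ht => (hD t ⟨ht.1, ht.2.le⟩).hasDerivWithinAt)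
    (B := fun t => ‖F (s * ω)‖ + (B t - B s)) (B' := B') (by simp)
    (fun t ht => (((hB t ⟨ht.1, ht.2.trans_lt hz1⟩).sub_const _).const_add
      _).continuousAt.continuousWithinAt)
    (fun t ht => ((hB t ⟨ht.1, ht.2.trans hz1⟩).sub_const _).const_add _ |>.hasDerivWithinAt)
    (fun t ht => by
      have h0 := hn t (hs.trans ht.1)
      have := hF' (t * ω) (mem_unitDisk_of_norm_lt (by rw [h0]; linarith [ht.2]))
        (by rw [h0]; exact ht.1)
      rw [norm_mul, hω, mul_one]
      rwa [h0] at this)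
    (⟨hsz, le_rfl⟩ : ‖z‖ ∈ Set.Icc s ‖z‖)
  refine ⟨s * ω, hn s hs, ?_⟩
  simpa [hzω] using key

lemma hasDerivAt_one_sub_rpow {α M t : ℝ} (hα : α ≠ 1) (ht : t < 1) :
    HasDerivAt (fun t => M * ((1 - t) ^ (1 - α) / (α - 1))) (M * (1 - t) ^ (-α)) t := by
  have h0 : α - 1 ≠ 0 := sub_ne_zero.2 hα
  have h1 : HasDerivAt (fun t : ℝ => 1 - t) (-1) t := (hasDerivAt_id t).const_sub 1
  have h2 := ((h1.rpow_const (p := 1 - α) (Or.inl (by linarith))).div_const (α - 1)).const_mul M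
  refine h2.congr_deriv ?_
  rw [show 1 - α - 1 = -α by ring]
  field_simp
  ring

lemma hasDerivAt_neg_log_one_sub {M t : ℝ} (ht : t < 1) :
    HasDerivAt (fun t => M * -Real.log (1 - t)) (M * (1 - t) ^ (-1 : ℝ)) t := by
  have h1 : HasDerivAt (fun t : ℝ => 1 - t) (-1) t := (hasDerivAt_id t).const_sub 1
  have h2 := ((h1.log (by linarith)).neg).const_mul M
  refine h2.congr_deriv ?_
  rw [Real.rpow_neg_one]
  ring

section Growth

variable {α M : ℝ} {F : ℂ → ℂ} {z : ℂ}

/-- For `α < 1` the majorant `(1 - t)^(-α)` is integrable up to `1`, so beyond radius `s` the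
function can grow only by `O((1 - s)^(1 - α))`. This is why no condition on `w` enters `R` in that
case. -/
lemma exists_norm_le_add_of_weight_lt_one (hα : 0 < α) (hα1 : α < 1)
    (hF : DifferentiableOn ℂ F unitDisk) (hM : 0 ≤ M)
    (hF' : ∀ z ∈ unitDisk, stdWeight α z * ‖deriv F z‖ ≤ M) {s : ℝ} (hs : 0 ≤ s)
    (hz : z ∈ unitDisk) (hsz : s ≤ ‖z‖) :
    ∃ ζ : ℂ, ‖ζ‖ = s ∧ ‖F z‖ ≤ ‖F ζ‖ + M * ((1 - s) ^ (1 - α) / (1 - α)) := by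
  obtain ⟨ζ, h1, h2⟩ := exists_norm_le_add_of_norm_deriv_le hF hs
    (fun t ht => hasDerivAt_one_sub_rpow (M := M) hα1.ne ht.2)
    (fun z hz _ => norm_le_rpow_of_stdWeight_mul_le hα hz (hF' z hz)) hz hsz
  refine ⟨ζ, h1, h2.trans (add_le_add le_rfl ?_)⟩
  have h3 : 0 ≤ M * ((1 - ‖z‖) ^ (1 - α) / (1 - α)) :=
    mul_nonneg hM (div_nonneg (Real.rpow_nonneg (by linarith [norm_lt_one_of_mem hz]) _)
      (by linarith))
  have h4 : ∀ x : ℝ, M * (x / (α - 1)) = -(M * (x / (1 - α))) := fun x => by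
    rw [← neg_sub 1 α, div_neg]; ring
  simp only [h4]
  linarith

lemma norm_le_of_weight_one (hF : DifferentiableOn ℂ F unitDisk) (hF0 : F 0 = 0)
    (hF' : ∀ z ∈ unitDisk, stdWeight 1 z * ‖deriv F z‖ ≤ M) (hz : z ∈ unitDisk) :
    ‖F z‖ ≤ M * -Real.log (1 - ‖z‖) := by
  obtain ⟨ζ, h1, h2⟩ := exists_norm_le_add_of_norm_deriv_le hF le_rfl
    (fun t ht => hasDerivAt_neg_log_one_sub (M := M) ht.2)
    (fun z hz _ => norm_le_rpow_of_stdWeight_mul_le one_pos hz (hF' z hz)) hz (norm_nonneg z)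
  obtain rfl : ζ = 0 := norm_eq_zero.1 h1
  simpa [hF0] using h2

lemma norm_le_of_one_lt_weight (hα1 : 1 < α) (hF : DifferentiableOn ℂ F unitDisk) (hF0 : F 0 = 0)
    (hM : 0 ≤ M)
    (hF' : ∀ z ∈ unitDisk, stdWeight α z * ‖deriv F z‖ ≤ M) (hz : z ∈ unitDisk) :
    ‖F z‖ ≤ M * ((1 - ‖z‖) ^ (1 - α) / (α - 1)) := by
  obtain ⟨ζ, h1, h2⟩ := exists_norm_le_add_of_norm_deriv_le hF le_rfl
    (fun t ht => hasDerivAt_one_sub_rpow (M := M) hα1.ne' ht.2)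
    (fun z hz _ => norm_le_rpow_of_stdWeight_mul_le (by linarith) hz (hF' z hz)) hz
    (norm_nonneg z)
  obtain rfl : ζ = 0 := norm_eq_zero.1 h1
  have h3 : 0 ≤ M * ((1 - (0 : ℝ)) ^ (1 - α) / (α - 1)) :=
    mul_nonneg hM (div_nonneg (by simp) (by linarith))
  rw [hF0, norm_zero] at h2
  linarith

end Growth

/-! ### Pointwise bounds, linearity and construction of members. -/

namespace ZygmundSpace

variable {α : ℝ}

lemma differentiableOn_deriv (f : ZygmundSpace α) : DifferentiableOn ℂ (deriv f) unitDisk :=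
  f.differentiableOn.deriv Metric.isOpen_ball

lemma differentiableOn_deriv_deriv (f : ZygmundSpace α) :
    DifferentiableOn ℂ (deriv (deriv f)) unitDisk :=
  f.differentiableOn_deriv.deriv Metric.isOpen_ball

lemma weight_mul_le_norm (f : ZygmundSpace α) {z : ℂ} (hz : z ∈ unitDisk) :
    stdWeight α z * ‖deriv (deriv f) z‖ ≤ ‖f‖ := by
  have h := le_ciSup f.bddAbove ⟨z, hz⟩
  rw [norm_def]
  have h0 := norm_nonneg (f 0)
  have h1 := norm_nonneg (deriv f 0)
  simp only at h
  linarith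

lemma norm_apply_zero_le (f : ZygmundSpace α) : ‖f 0‖ ≤ ‖f‖ := by
  rw [norm_def]
  linarith [norm_nonneg (deriv f 0), f.iSup_nonneg]

lemma norm_deriv_zero_le (f : ZygmundSpace α) : ‖deriv f 0‖ ≤ ‖f‖ := by
  rw [norm_def]
  linarith [norm_nonneg (f 0), f.iSup_nonneg]

lemma norm_le_of_forall (f : ZygmundSpace α) {C : ℝ}
    (hC : ∀ z ∈ unitDisk, stdWeight α z * ‖deriv (deriv f) z‖ ≤ C) :
    ‖f‖ ≤ ‖f 0‖ + ‖deriv f 0‖ + C := by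
  have : Nonempty unitDisk := ⟨⟨0, zero_mem_unitDisk⟩⟩
  rw [norm_def]
  exact add_le_add le_rfl (ciSup_le fun z => hC z z.2)

lemma coe_sub (f g : ZygmundSpace α) : (⇑(f - g) : ℂ → ℂ) = f - g := rfl

lemma deriv_add (f g : ZygmundSpace α) :
    Set.EqOn (deriv (f + g : ZygmundSpace α)) (deriv f + deriv g) unitDisk :=
  deriv_add_unitDisk f.differentiableOn g.differentiableOn

lemma deriv_deriv_add (f g : ZygmundSpace α) :
    Set.EqOn (deriv (deriv (f + g : ZygmundSpace α))) (deriv (deriv f) + deriv (deriv g))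
      unitDisk :=
  deriv_deriv_add_unitDisk f.differentiableOn g.differentiableOn

lemma deriv_sub (f g : ZygmundSpace α) :
    Set.EqOn (deriv (f - g : ZygmundSpace α)) (deriv f - deriv g) unitDisk := fun z hz => by
  have h := deriv_add (f - g) g hz
  rw [sub_add_cancel] at h
  simp only [Pi.add_apply, Pi.sub_apply] at h ⊢
  rw [h]; ring

lemma deriv_deriv_sub (f g : ZygmundSpace α) :
    Set.EqOn (deriv (deriv (f - g : ZygmundSpace α))) (deriv (deriv f) - deriv (deriv g))
      unitDisk := fun z hz => by
  have h := deriv_deriv_add (f - g) g hz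
  rw [sub_add_cancel] at h
  simp only [Pi.add_apply, Pi.sub_apply] at h ⊢
  rw [h]; ring

lemma deriv_smul (c : ℂ) (f : ZygmundSpace α) :
    deriv (c • f : ZygmundSpace α) = c • deriv f := by
  rw [coe_smul, deriv_smul_fun]

lemma deriv_deriv_smul (c : ℂ) (f : ZygmundSpace α) :
    deriv (deriv (c • f : ZygmundSpace α)) = c • deriv (deriv f) := by
  rw [deriv_smul, deriv_smul_fun]

lemma exists_eqOn {f : ℂ → ℂ} (hf : DifferentiableOn ℂ f unitDisk) {C : ℝ}
    (hC : ∀ z ∈ unitDisk, stdWeight α z * ‖deriv (deriv f) z‖ ≤ C) :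
    ∃ F : ZygmundSpace α, Set.EqOn F f unitDisk := by
  have he : Set.EqOn (unitDisk.indicator f) f unitDisk := fun z hz => Set.indicator_of_mem hz f
  refine ⟨⟨unitDisk.indicator f, hf.congr he, fun z hz => Set.indicator_of_notMem hz f, C,
    fun z hz => ?_⟩, he⟩
  rw [(he.deriv Metric.isOpen_ball).deriv Metric.isOpen_ball hz]
  exact hC z hz

/-- Only `f'` and `f''` are seen by the operator, so test functions are prescribed through `F = f'`;
`f` is the primitive vanishing at `0`, extended by `0` off the disk. -/
lemma exists_deriv_eqOn {F : ℂ → ℂ} (hF : DifferentiableOn ℂ F unitDisk) {C : ℝ}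
    (hC : ∀ z ∈ unitDisk, stdWeight α z * ‖deriv F z‖ ≤ C) :
    ∃ f : ZygmundSpace α, f 0 = 0 ∧ Set.EqOn (deriv f) F unitDisk ∧
      Set.EqOn (deriv (deriv f)) (deriv F) unitDisk ∧ ‖f‖ ≤ ‖F 0‖ + C := by
  obtain ⟨G, hG0, hG⟩ := hF.isExactOn_ball.with_val_at 0 0
  have hG1 : Set.EqOn (deriv G) F unitDisk := fun z hz => (hG z hz).deriv
  have hG2 : Set.EqOn (deriv (deriv G)) (deriv F) unitDisk := hG1.deriv Metric.isOpen_ball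
  obtain ⟨f, hf⟩ := exists_eqOn (α := α) (f := G) (C := C)
    (fun z hz => (hG z hz).differentiableAt.differentiableWithinAt)
    (fun z hz => by rw [hG2 hz]; exact hC z hz)
  have hf1 := (hf.deriv Metric.isOpen_ball).trans hG1
  have hf2 := hf1.deriv Metric.isOpen_ball
  have hf0 : f 0 = 0 := (hf zero_mem_unitDisk).trans hG0
  refine ⟨f, hf0, hf1, hf2, ?_⟩
  have h := f.norm_le_of_forall (C := C) fun z hz => by rw [hf2 hz]; exact hC z hz
  rwa [hf0, norm_zero, zero_add, hf1 zero_mem_unitDisk] at h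

end ZygmundSpace

/-! ### Compact operators on asymptotically disjoint families. -/

/-- A bounded family that is asymptotically disjoint from every member of `X₀`
is mapped to a null family by compact operators. -/
lemma IsCompactOperator.tendsto_zero_of_disjoint {E F ι : Type*} [NormedAddCommGroup E]
    [NormedSpace ℂ E] [NormedAddCommGroup F] [NormedSpace ℂ F] {K : E →L[ℂ] F}
    (hK : IsCompactOperator K) {l : Filter ι} {f : ι → E} {X₀ : AddSubmonoid E}
    (hf : ∀ i, f i ∈ X₀) {M : ℝ} (hM : ∀ i, ‖f i‖ ≤ M) {p : E → ℝ} (hp : ∀ S, ‖S‖ ≤ 2 * p S)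
    (hp0 : p 0 = 0) (hdis : ∀ S ∈ X₀, ∀ ε > 0, ∀ᶠ i in l, p (S + f i) ≤ max (p S) M + ε) :
    Filter.Tendsto (fun i => K (f i)) l (nhds 0) := by
  -- Along an ultrafilter, compactness provides a limit `y` of the images; it remains to exclude `y
  -- ≠ 0`.
  rw [Filter.tendsto_iff_ultrafilter]
  intro g hg
  obtain ⟨C, hC, hKC⟩ := hK.image_closedBall_subset_compact (f := K.toLinearMap) M
  have hmem : ∀ i, K (f i) ∈ C := fun i => hKC ⟨f i, by simpa using hM i, rfl⟩
  obtain ⟨y, -, hy⟩ := hC.ultrafilter_le_nhds (g.map fun i => K (f i))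
    (Filter.le_principal_iff.2 (Filter.mem_map.2 (Filter.univ_mem' hmem)))
  have hy' : Filter.Tendsto (fun i => K (f i)) g (nhds y) := hy
  suffices y = 0 by rwa [this] at hy'
  by_contra hy0
  have hny : 0 < ‖y‖ := norm_pos_iff.2 hy0
  -- `δ` is the loss allowed for each added summand. After `N` summands it contributes at most `2
  -- ‖K‖ N δ ≤ N ‖y‖ / 8` to the norm of the image.
  obtain ⟨δ, hδ, hKδ⟩ : ∃ δ > 0, ‖K‖ * δ ≤ ‖y‖ / 16 :=
    ⟨‖y‖ / 16 / (‖K‖ + 1), by positivity, by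
      rw [← mul_div_assoc, div_le_iff₀ (by positivity)]
      nlinarith [norm_nonneg K]⟩
  have hM0 : 0 ≤ M := by
    obtain ⟨i⟩ := Filter.nonempty_of_neBot (g : Filter ι)
    exact (norm_nonneg _).trans (hM i)
  -- Add members of the family one at a time, each chosen almost disjoint from the current sum: `p`
  -- rises by at most `δ`, while the image moves by nearly `y`.
  have hsum : ∀ N : ℕ, ∃ S ∈ X₀, p S ≤ M + N * δ ∧ ‖K S - (N : ℂ) • y‖ ≤ N * (‖y‖ / 2) := by
    intro N
    induction N with
    | zero => exact ⟨0, X₀.zero_mem, by simpa [hp0] using hM0, by simp⟩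
    | succ N ih =>
      obtain ⟨S, hS, hSn, hKS⟩ := ih
      have h1 : ∀ᶠ i in g, ‖K (f i) - y‖ < ‖y‖ / 2 := by
        have := hy'.eventually (Metric.ball_mem_nhds y (half_pos hny))
        simpa [dist_eq_norm] using this
      obtain ⟨i, hi1, hi2⟩ := (h1.and ((hdis S hS δ hδ).filter_mono hg)).exists
      refine ⟨S + f i, X₀.add_mem hS (hf i), ?_, ?_⟩
      · push_cast
        have : max (p S) M ≤ M + N * δ := max_le hSn (by nlinarith [N.cast_nonneg (α := ℝ)])
        linarith
      · have : K (S + f i) - ((N + 1 : ℕ) : ℂ) • y = (K S - (N : ℂ) • y) + (K (f i) - y) := by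
          rw [map_add]; push_cast; rw [add_smul, one_smul]; abel
        rw [this]
        push_cast
        linarith [norm_add_le (K S - (N : ℂ) • y) (K (f i) - y)]
  -- For this `N` also `2 ‖K‖ M < N ‖y‖ / 8`, so the image of the sum has norm below `N ‖y‖ / 4`,
  -- although it lies within `N ‖y‖ / 2` of `N y`.
  obtain ⟨N, hN⟩ := exists_nat_gt (‖K‖ * M / (‖y‖ / 16))
  rw [div_lt_iff₀ (by positivity)] at hN
  obtain ⟨S, -, hSn, hKS⟩ := hsum N
  have h1 : ‖(N : ℂ) • y‖ = N * ‖y‖ := by simp [norm_smul]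
  have h2 : ‖(N : ℂ) • y‖ ≤ ‖K S‖ + ‖K S - (N : ℂ) • y‖ := by
    have := norm_sub_norm_le ((N : ℂ) • y) (K S)
    rw [norm_sub_rev] at this
    linarith
  have h3 : ‖K S‖ ≤ ‖K‖ * (2 * (M + N * δ)) :=
    (K.le_opNorm S).trans (mul_le_mul_of_nonneg_left ((hp S).trans (by linarith)) (norm_nonneg K))
  have h4 : (N : ℝ) * (‖K‖ * δ) ≤ N * (‖y‖ / 16) := by gcongr
  nlinarith

namespace ZygmundSpace

variable {α : ℝ}

/-- The little Zygmund type space: `(1 - |z|²)^α f''(z) → 0` as `|z| → 1`. -/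
def little (α : ℝ) : AddSubmonoid (ZygmundSpace α) where
  carrier := {f | ∀ ε > 0, ∃ r < 1, ∀ z ∈ unitDisk, r < ‖z‖ →
    stdWeight α z * ‖deriv (deriv f) z‖ ≤ ε}
  zero_mem' := fun ε hε => ⟨0, one_pos, fun z _ _ => by
    have h : deriv (0 : ℂ → ℂ) = 0 := by funext z; simp
    simp [coe_zero, h, hε.le]⟩
  add_mem' := by
    intro f g hf hg ε hε
    obtain ⟨r, hr, h⟩ := hf (ε / 2) (half_pos hε)
    obtain ⟨r', hr', h'⟩ := hg (ε / 2) (half_pos hε)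
    refine ⟨max r r', max_lt hr hr', fun z hz hrz => ?_⟩
    have h1 := h z hz ((le_max_left _ _).trans_lt hrz)
    have h2 := h' z hz ((le_max_right _ _).trans_lt hrz)
    rw [deriv_deriv_add f g hz, Pi.add_apply]
    have := mul_le_mul_of_nonneg_left (norm_add_le (deriv (deriv f) z) (deriv (deriv g) z))
      (stdWeight_nonneg α hz)
    linarith

lemma sub_mem_little {f g : ZygmundSpace α} (hf : f ∈ little α) (hg : g ∈ little α) :
    f - g ∈ little α := by
  rw [sub_eq_add_neg]
  refine add_mem hf fun ε hε => ?_
  obtain ⟨r, hr, h⟩ := hg ε hε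
  refine ⟨r, hr, fun z hz hrz => ?_⟩
  have : -g = (-1 : ℂ) • g := by simp
  rw [this, deriv_deriv_smul]
  simpa using h z hz hrz

/-- A bounded family in the little Zygmund type space tending to zero locally uniformly. -/
structure IsNullFamily {ι : Type*} (l : Filter ι) (f : ι → ZygmundSpace α) (M : ℝ) : Prop where
  mem_little : ∀ i, f i ∈ little α
  norm_le : ∀ i, ‖f i‖ ≤ M
  apply_zero : ∀ i, f i 0 = 0
  deriv_zero : ∀ ε > 0, ∀ᶠ i in l, ‖deriv (f i) 0‖ ≤ ε
  deriv_deriv : ∀ r < 1, ∀ ε > 0, ∀ᶠ i in l, ∀ z : ℂ, ‖z‖ ≤ r → ‖deriv (deriv (f i)) z‖ ≤ ε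

lemma IsNullFamily.sub {ι : Type*} {l : Filter ι} {f g : ι → ZygmundSpace α} {M N : ℝ}
    (hf : IsNullFamily l f M) (hg : IsNullFamily l g N) :
    IsNullFamily l (fun i => f i - g i) (M + N) where
  mem_little i := sub_mem_little (hf.mem_little i) (hg.mem_little i)
  norm_le i := (norm_sub_le _ _).trans (add_le_add (hf.norm_le i) (hg.norm_le i))
  apply_zero i := by rw [coe_sub, Pi.sub_apply, hf.apply_zero, hg.apply_zero, sub_zero]
  deriv_zero ε hε := by
    filter_upwards [hf.deriv_zero (ε / 2) (half_pos hε), hg.deriv_zero (ε / 2) (half_pos hε)]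
      with i h1 h2
    rw [deriv_sub _ _ zero_mem_unitDisk, Pi.sub_apply]
    linarith [norm_sub_le (deriv (f i) 0) (deriv (g i) 0)]
  deriv_deriv r hr ε hε := by
    filter_upwards [hf.deriv_deriv r hr (ε / 2) (half_pos hε),
      hg.deriv_deriv r hr (ε / 2) (half_pos hε)] with i h1 h2 z hz
    rw [deriv_deriv_sub _ _ (mem_unitDisk_of_norm_lt (hz.trans_lt hr)), Pi.sub_apply]
    linarith [norm_sub_le (deriv (deriv (f i)) z) (deriv (deriv (g i)) z), h1 z hz, h2 z hz]

lemma stdWeight_le_one (hα : 0 < α) {z : ℂ} (hz : z ∈ unitDisk) : stdWeight α z ≤ 1 := by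
  simpa using stdWeight_le_rpow_of_le hα hz (x := 1) (by nlinarith [norm_nonneg z])

/-- A seminorm equivalent to the norm, better adapted to sums of disjoint functions. -/
def maxNorm (f : ZygmundSpace α) : ℝ :=
  max (‖f 0‖ + ‖deriv f 0‖) (⨆ z : unitDisk, stdWeight α z * ‖deriv (deriv f) z‖)

lemma norm_le_two_mul_maxNorm (f : ZygmundSpace α) : ‖f‖ ≤ 2 * maxNorm f := by
  rw [norm_def, two_mul]
  exact add_le_add (le_max_left _ _) (le_max_right _ _)

lemma maxNorm_zero : maxNorm (0 : ZygmundSpace α) = 0 := by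
  have h : deriv (0 : ℂ → ℂ) = 0 := by funext z; simp
  simp [maxNorm, coe_zero, h]

/-- Inside radius `r` the second derivative of `f i` is negligible, outside it the weighted second
derivative of `S` is. Hence the supremum of the sum is nearly the maximum of the two suprema. The
terms at `0` enter a maximum too, because the summed norm would not obey such an estimate. -/
lemma IsNullFamily.eventually_maxNorm_add_le (hα : 0 < α) {ι : Type*} {l : Filter ι}
    {f : ι → ZygmundSpace α} {M : ℝ} (hf : IsNullFamily l f M) {S : ZygmundSpace α}
    (hS : S ∈ little α) {ε : ℝ} (hε : 0 < ε) :
    ∀ᶠ i in l, maxNorm (S + f i) ≤ max (maxNorm S) M + ε := by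
  have : Nonempty unitDisk := ⟨⟨0, zero_mem_unitDisk⟩⟩
  obtain ⟨r, hr, hSr⟩ := hS ε hε
  filter_upwards [hf.deriv_zero ε hε, hf.deriv_deriv r hr ε hε] with i h0 h2
  refine max_le ?_ (ciSup_le fun z => ?_)
  · rw [deriv_add _ _ zero_mem_unitDisk, Pi.add_apply, coe_add, Pi.add_apply, hf.apply_zero,
      add_zero]
    have h3 := norm_add_le (deriv S 0) (deriv (f i) 0)
    have h4 : ‖S 0‖ + ‖deriv S 0‖ ≤ max (maxNorm S) M :=
      (le_max_left _ _).trans (le_max_left _ _)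
    linarith
  · obtain ⟨z, hz⟩ := z
    simp only
    rw [deriv_deriv_add _ _ hz, Pi.add_apply]
    have hadd := mul_le_mul_of_nonneg_left
      (norm_add_le (deriv (deriv S) z) (deriv (deriv (f i)) z)) (stdWeight_nonneg α hz)
    rw [mul_add] at hadd
    rcases le_or_gt ‖z‖ r with hzr | hzr
    · have h5 : stdWeight α z * ‖deriv (deriv S) z‖ ≤ max (maxNorm S) M :=
        (le_ciSup S.bddAbove ⟨z, hz⟩).trans ((le_max_right _ _).trans (le_max_left _ _))
      have h6 := mul_le_mul (stdWeight_le_one hα hz) (h2 z hzr) (norm_nonneg _) zero_le_one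
      linarith
    · have h5 := hSr z hz hzr
      have h6 := ((f i).weight_mul_le_norm hz).trans (hf.norm_le i)
      linarith [le_max_right (maxNorm S) M]

/-- Plays the role of weak convergence to `0` of the test functions. -/
lemma IsNullFamily.tendsto_of_isCompactOperator (hα : 0 < α) {ι : Type*} {l : Filter ι}
    {f : ι → ZygmundSpace α} {M : ℝ} (hf : IsNullFamily l f M) {F : Type*}
    [NormedAddCommGroup F] [NormedSpace ℂ F] {K : ZygmundSpace α →L[ℂ] F}
    (hK : IsCompactOperator K) : Filter.Tendsto (fun i => K (f i)) l (nhds 0) :=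
  hK.tendsto_zero_of_disjoint hf.mem_little hf.norm_le norm_le_two_mul_maxNorm maxNorm_zero
    fun _ hS _ hε => hf.eventually_maxNorm_add_le hα hS hε

end ZygmundSpace

/-! ### Finite rank approximation of the identity. -/

namespace ZygmundSpace

variable {α : ℝ}

lemma norm_deriv_deriv_le (hα : 0 < α) (f : ZygmundSpace α) {ρ : ℝ} (hρ : ρ < 1) {z : ℂ}
    (hz : ‖z‖ ≤ ρ) : ‖deriv (deriv f) z‖ ≤ ‖f‖ * (1 - ρ) ^ (-α) := by
  have hzD := mem_unitDisk_of_norm_lt (hz.trans_lt hρ)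
  refine (norm_le_rpow_of_stdWeight_mul_le hα hzD (f.weight_mul_le_norm hzD)).trans ?_
  exact mul_le_mul_of_nonneg_left (Real.rpow_le_rpow_of_nonpos (by linarith) (by linarith)
    (by linarith)) (norm_nonneg f)

/-- The Taylor coefficients of `f''` at `0`. -/
def coeff (n : ℕ) (f : ZygmundSpace α) : ℂ :=
  (n.factorial : ℂ)⁻¹ * iteratedDeriv n (deriv (deriv f)) 0

lemma contDiffAt_deriv_deriv (n : ℕ) (f : ZygmundSpace α) :
    ContDiffAt ℂ n (deriv (deriv f)) 0 :=
  (f.differentiableOn_deriv_deriv.analyticAt (unitDisk_mem_nhds zero_mem_unitDisk)).contDiffAt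

lemma coeff_add (n : ℕ) (f g : ZygmundSpace α) : coeff n (f + g) = coeff n f + coeff n g := by
  have h := (deriv_deriv_add f g).eventuallyEq_of_mem (unitDisk_mem_nhds zero_mem_unitDisk)
  rw [coeff, h.iteratedDeriv_eq n, iteratedDeriv_add (contDiffAt_deriv_deriv n f)
    (contDiffAt_deriv_deriv n g), mul_add]
  rfl

lemma coeff_smul (n : ℕ) (c : ℂ) (f : ZygmundSpace α) : coeff n (c • f) = c * coeff n f := by
  rw [coeff, deriv_deriv_smul, iteratedDeriv_const_smul_field, coeff, smul_eq_mul]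
  ring

lemma norm_coeff_le (hα : 0 < α) (n : ℕ) (f : ZygmundSpace α) {ρ : ℝ} (hρ0 : 0 < ρ)
    (hρ : ρ < 1) : ‖coeff n f‖ ≤ ‖f‖ * (1 - ρ) ^ (-α) / ρ ^ n := by
  have hsub : Metric.closedBall (0 : ℂ) ρ ⊆ unitDisk := Metric.closedBall_subset_ball hρ
  have h := Complex.norm_iteratedDeriv_le_of_forall_mem_sphere_norm_le n hρ0
    (f.differentiableOn_deriv_deriv.diffContOnCl_ball hsub)
    (C := ‖f‖ * (1 - ρ) ^ (-α))
    (fun z hz => f.norm_deriv_deriv_le hα hρ (by simpa using hz.le))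
  have hn : (0 : ℝ) < n.factorial := by positivity
  rw [coeff, norm_mul, norm_inv, Complex.norm_natCast, inv_mul_le_iff₀ hn, ← mul_div_assoc]
  exact h

/-- `coeff` as a continuous linear functional. -/
def coeffCLM (hα : 0 < α) (n : ℕ) : ZygmundSpace α →L[ℂ] ℂ :=
  LinearMap.mkContinuous ⟨⟨coeff n, coeff_add n⟩, coeff_smul n⟩
    ((1 - 1 / 2 : ℝ) ^ (-α) / (1 / 2) ^ n) fun f => by
      refine (norm_coeff_le hα n f one_half_pos (by norm_num)).trans_eq ?_
      ring

/-- Evaluation at `0`. -/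
def evalZeroCLM : ZygmundSpace α →L[ℂ] ℂ :=
  LinearMap.mkContinuous ⟨⟨fun f => f 0, fun _ _ => rfl⟩, fun _ _ => rfl⟩ 1
    fun f => (f.norm_apply_zero_le).trans_eq (one_mul _).symm

/-- Evaluation of `f'` at a point of the disk. -/
def derivEval {z : ℂ} (hz : z ∈ unitDisk) : ZygmundSpace α →ₗ[ℂ] ℂ :=
  ⟨⟨fun f => deriv f z, fun f g => deriv_add f g hz⟩, fun c f => congrFun (deriv_smul c f) z⟩

/-- Evaluation of `f''` at a point of the disk. -/
def derivDerivEval {z : ℂ} (hz : z ∈ unitDisk) : ZygmundSpace α →ₗ[ℂ] ℂ :=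
  ⟨⟨fun f => deriv (deriv f) z, fun f g => deriv_deriv_add f g hz⟩,
    fun c f => congrFun (deriv_deriv_smul c f) z⟩

/-- Evaluation of `f'` at `0`. -/
def derivZeroCLM : ZygmundSpace α →L[ℂ] ℂ :=
  LinearMap.mkContinuous (derivEval zero_mem_unitDisk) 1 fun f =>
    (f.norm_deriv_zero_le).trans_eq (one_mul _).symm

lemma exists_monomial (hα : 0 < α) (n : ℕ) : ∃ f : ZygmundSpace α, f 0 = 0 ∧ deriv f 0 = 0 ∧
    (∀ z ∈ unitDisk, deriv f z = z ^ (n + 1) / (n + 1)) ∧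
    ∀ z ∈ unitDisk, deriv (deriv f) z = z ^ n := by
  have hn : (n + 1 : ℂ) ≠ 0 := Nat.cast_add_one_ne_zero n
  have hd : ∀ z : ℂ, HasDerivAt (fun z : ℂ => z ^ (n + 1) / (n + 1)) (z ^ n) z := fun z => by
    refine ((hasDerivAt_pow (n + 1) z).div_const (n + 1 : ℂ)).congr_deriv ?_
    rw [Nat.add_sub_cancel]
    push_cast
    field_simp
  obtain ⟨f, h0, h1, h2, -⟩ := exists_deriv_eqOn (α := α) (C := 1)
    (F := fun z : ℂ => z ^ (n + 1) / (n + 1))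
    (fun z _ => (hd z).differentiableAt.differentiableWithinAt) fun z hz => by
      rw [(hd z).deriv, norm_pow]
      exact mul_le_one₀ (stdWeight_le_one hα hz) (by positivity)
        (pow_le_one₀ (norm_nonneg z) (norm_lt_one_of_mem hz).le)
  exact ⟨f, h0, by simp [h1 zero_mem_unitDisk], fun z hz => h1 hz,
    fun z hz => by rw [h2 hz, (hd z).deriv]⟩

lemma exists_identity : ∃ f : ZygmundSpace α, f 0 = 0 ∧ (∀ z ∈ unitDisk, deriv f z = 1) ∧
    ∀ z ∈ unitDisk, deriv (deriv f) z = 0 := by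
  obtain ⟨f, h0, h1, h2, -⟩ := exists_deriv_eqOn (α := α) (C := 0) (F := fun _ => (1 : ℂ))
    (differentiableOn_const 1) fun z hz => by simp
  exact ⟨f, h0, fun z hz => h1 hz, fun z hz => by rw [h2 hz]; simp⟩

lemma exists_one : ∃ f : ZygmundSpace α, f 0 = 1 ∧ (∀ z ∈ unitDisk, deriv f z = 0) ∧
    ∀ z ∈ unitDisk, deriv (deriv f) z = 0 := by
  obtain ⟨f, h⟩ := exists_eqOn (α := α) (C := 0) (f := fun _ => (1 : ℂ))
    (differentiableOn_const 1) fun z hz => by simp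
  have h1 := h.deriv Metric.isOpen_ball
  refine ⟨f, h zero_mem_unitDisk, fun z hz => by rw [h1 hz]; simp, fun z hz => ?_⟩
  rw [h1.deriv Metric.isOpen_ball hz]
  simp

lemma isCompactOperator_smulRight {E F : Type*} [NormedAddCommGroup E] [NormedSpace ℂ E]
    [NormedAddCommGroup F] [NormedSpace ℂ F] (l : E →L[ℂ] ℂ) (y : F) :
    IsCompactOperator (l.smulRight y) := by
  have h : IsCompactOperator l :=
    isCompactOperator_of_locallyCompactSpace_dom l
  exact h.clm_comp (ContinuousLinearMap.toSpanSingleton ℂ y)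

/-- There are finite rank operators with prescribed Taylor coefficients `r^n c_n`. -/
lemma exists_isCompactOperator_deriv_deriv_eq (hα : 0 < α) (a : ℕ → ℂ) (N : ℕ) :
    ∃ P : ZygmundSpace α →L[ℂ] ZygmundSpace α, IsCompactOperator P ∧ ∀ f,
      (f - P f) 0 = 0 ∧ deriv (f - P f) 0 = 0 ∧ ∀ z ∈ unitDisk,
        deriv (deriv (f - P f)) z = deriv (deriv f) z -
          ∑ n ∈ Finset.range N, a n * coeff n f * z ^ n := by
  obtain ⟨e, he0, he1, he2⟩ := exists_one (α := α)
  obtain ⟨d, hd0, hd1, hd2⟩ := exists_identity (α := α)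
  choose m hm0 hm1 _ hm2 using exists_monomial hα
  let Q : ℕ → ZygmundSpace α →L[ℂ] ZygmundSpace α := fun N =>
    (∑ n ∈ Finset.range N, (coeffCLM hα n).smulRight (a n • m n))
  have hQc : IsCompactOperator (Q N) := by
    induction N with
    | zero => simpa [Q] using isCompactOperator_zero
    | succ N ih =>
      have : Q (N + 1) = Q N + (coeffCLM hα N).smulRight (a N • m N) :=
        Finset.sum_range_succ _ _
      rw [this]
      exact ih.add (isCompactOperator_smulRight _ _)
  have hQ : ∀ f, Q N f = ∑ n ∈ Finset.range N, coeff n f • a n • m n := fun f => by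
    simp only [Q, sum_apply]
    rfl
  refine ⟨evalZeroCLM.smulRight e + derivZeroCLM.smulRight d + Q N,
    ((isCompactOperator_smulRight _ _).add (isCompactOperator_smulRight _ _)).add hQc,
    fun f => ?_⟩
  set P := evalZeroCLM.smulRight e + derivZeroCLM.smulRight d + Q N
  have hP : P f = f 0 • e + deriv f 0 • d + ∑ n ∈ Finset.range N, coeff n f • a n • m n := by
    rw [← hQ]; rfl
  rw [hP]
  refine ⟨?_, ?_, fun z hz => ?_⟩
  · change evalZeroCLM (f - _) = 0
    have h0 : evalZeroCLM e = 1 := he0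
    have h1 : evalZeroCLM d = 0 := hd0
    have h2 : ∀ n, evalZeroCLM (m n) = 0 := hm0
    have h3 : evalZeroCLM f = f 0 := rfl
    simp [h0, h1, h2, h3]
  · change derivEval zero_mem_unitDisk (f - _) = 0
    have h0 : derivEval zero_mem_unitDisk e = 0 := he1 0 zero_mem_unitDisk
    have h1 : derivEval zero_mem_unitDisk d = 1 := hd1 0 zero_mem_unitDisk
    have h2 : ∀ n, derivEval zero_mem_unitDisk (m n) = 0 := hm1
    have h3 : derivEval zero_mem_unitDisk f = deriv f 0 := rfl
    simp [h0, h1, h2, h3]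
  · change derivDerivEval hz (f - _) = _
    have h0 : derivDerivEval hz e = 0 := he2 z hz
    have h1 : derivDerivEval hz d = 0 := hd2 z hz
    have h2 : ∀ n, derivDerivEval hz (m n) = z ^ n := fun n => hm2 n z hz
    have h3 : derivDerivEval hz f = deriv (deriv f) z := rfl
    simp only [map_sub, map_add, map_smul, map_sum, h0, h1, h2, h3, smul_eq_mul, mul_zero,
      zero_add]
    congr 1
    exact Finset.sum_congr rfl fun n _ => by ring

/-- Cauchy's estimate on disks of radius `δ` bounds `f'''` on `|z| ≤ s` by `A ‖f‖`, and `z` moves by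
at most `1 - r`. -/
lemma exists_dilation_close (hα : 0 < α) {s : ℝ} (hs : s < 1) {ε : ℝ} (hε : 0 < ε) :
    ∃ r : ℝ, 0 < r ∧ r < 1 ∧ ∀ f : ZygmundSpace α, ∀ z : ℂ, ‖z‖ ≤ s →
      ‖deriv (deriv f) z - deriv (deriv f) (r * z)‖ ≤ ε * ‖f‖ := by
  set δ := (1 - s) / 2 with hδ
  have hδ0 : 0 < δ := by rw [hδ]; linarith
  set A := (1 - (s + δ)) ^ (-α) / δ with hA
  have hA0 : 0 < A := div_pos (Real.rpow_pos_of_pos (by linarith) _) hδ0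
  -- The entry `1 - ε / A` does the work; `1 / 2` only keeps `r` positive.
  refine ⟨max (1 / 2) (1 - ε / A), by positivity, max_lt (by norm_num)
    (by linarith [div_pos hε hA0]), fun f z hz => ?_⟩
  set r := max (1 / 2) (1 - ε / A)
  have hr0 : 0 < r := lt_max_of_lt_left one_half_pos
  have hr1 : r ≤ 1 := max_le (by norm_num) (by linarith [div_pos hε hA0])
  have hs0 : 0 ≤ s := (norm_nonneg z).trans hz
  have hb : ∀ x ∈ Metric.closedBall (0 : ℂ) s, ‖deriv (deriv (deriv f)) x‖ ≤ ‖f‖ * A := by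
    intro x hx
    have hx' : ‖x‖ ≤ s := by simpa using hx
    have hball : ∀ y ∈ Metric.closedBall x δ, ‖y‖ ≤ s + δ := fun y hy => by
      have : ‖y - x‖ ≤ δ := by simpa [dist_eq_norm] using hy
      linarith [norm_le_insert' y x]
    have h := Complex.norm_deriv_le_of_forall_mem_sphere_norm_le hδ0
      (f.differentiableOn_deriv_deriv.diffContOnCl_ball (c := x) (R := δ)
        fun y hy => mem_unitDisk_of_norm_lt (by linarith [hball y hy]))
      (C := ‖f‖ * (1 - (s + δ)) ^ (-α))
      fun y hy => f.norm_deriv_deriv_le hα (by linarith)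
        (hball y (Metric.sphere_subset_closedBall hy))
    rwa [mul_div_assoc] at h
  have h := (convex_closedBall (0 : ℂ) s).norm_image_sub_le_of_norm_deriv_le
    (f := deriv (deriv f)) (x := r * z) (y := z)
    (fun x hx => f.differentiableOn_deriv_deriv.differentiableAt
      (unitDisk_mem_nhds (Metric.closedBall_subset_ball hs hx))) hb
    (by
      simp only [mem_closedBall_zero_iff, norm_mul, Complex.norm_real, Real.norm_of_nonneg hr0.le]
      nlinarith [norm_nonneg z]) (by simpa using hz)
  refine h.trans ?_
  have h1 : ‖z - r * z‖ ≤ ε / A := by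
    have : z - r * z = ((1 - r : ℝ) : ℂ) * z := by push_cast; ring
    rw [this, norm_mul, Complex.norm_real, Real.norm_of_nonneg (by linarith)]
    have : 1 - ε / A ≤ r := le_max_right _ _
    nlinarith [norm_nonneg z]
  calc ‖f‖ * A * ‖z - r * z‖ ≤ ‖f‖ * A * (ε / A) :=
        mul_le_mul_of_nonneg_left h1 (mul_nonneg (norm_nonneg f) hA0.le)
    _ = ε * ‖f‖ := by field_simp

/-- The Cauchy estimate at a radius `ρ` between `r` and `1` makes the terms of the dilated series
geometric with ratio `r / ρ`, so one `N` serves all `f` and all of the disk. -/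
lemma exists_taylor_close (hα : 0 < α) {r : ℝ} (hr0 : 0 < r) (hr : r < 1) {ε : ℝ} (hε : 0 < ε) :
    ∃ N : ℕ, ∀ f : ZygmundSpace α, ∀ z ∈ unitDisk,
      ‖deriv (deriv f) (r * z) - ∑ n ∈ Finset.range N, (r : ℂ) ^ n * coeff n f * z ^ n‖ ≤
        ε * ‖f‖ := by
  set ρ := (1 + r) / 2 with hρ
  have hρ0 : 0 < ρ := by rw [hρ]; linarith
  have hρ1 : ρ < 1 := by rw [hρ]; linarith
  set q := r / ρ with hq
  have hq0 : 0 < q := div_pos hr0 hρ0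
  have hq1 : q < 1 := by rw [hq, div_lt_one hρ0, hρ]; linarith
  set A := (1 - ρ) ^ (-α) / (1 - q) with hA
  have hA0 : 0 < A := div_pos (Real.rpow_pos_of_pos (by linarith) _) (by linarith)
  obtain ⟨N, hN⟩ := exists_pow_lt_of_lt_one (div_pos hε hA0) hq1
  refine ⟨N, fun f z hz => ?_⟩
  have hz1 := norm_lt_one_of_mem hz
  have hrz : (r : ℂ) * z ∈ unitDisk := mem_unitDisk_of_norm_lt (by
    rw [norm_mul, Complex.norm_real, Real.norm_of_nonneg hr0.le]
    nlinarith [norm_nonneg z])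
  have hsum := Complex.hasSum_taylorSeries_on_ball f.differentiableOn_deriv_deriv hrz
  have hsum' : HasSum (fun n => (r : ℂ) ^ n * coeff n f * z ^ n) (deriv (deriv f) (r * z)) := by
    refine hsum.congr_fun fun n => ?_
    rw [sub_zero, coeff, smul_eq_mul, smul_eq_mul, mul_pow]
    ring
  have hb : ∀ n, ‖(r : ℂ) ^ n * coeff n f * z ^ n‖ ≤ ‖f‖ * (1 - ρ) ^ (-α) * q ^ n := fun n => by
    rw [norm_mul, norm_mul, norm_pow, norm_pow, Complex.norm_real, Real.norm_of_nonneg hr0.le]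
    have h1 := norm_coeff_le hα n f hρ0 hρ1
    have h2 : ‖z‖ ^ n ≤ 1 := pow_le_one₀ (norm_nonneg z) hz1.le
    calc r ^ n * ‖coeff n f‖ * ‖z‖ ^ n ≤ r ^ n * ‖coeff n f‖ * 1 := by gcongr
      _ ≤ r ^ n * (‖f‖ * (1 - ρ) ^ (-α) / ρ ^ n) * 1 := by gcongr
      _ = _ := by rw [hq, div_pow r ρ n]; ring
  have h := norm_sub_le_of_geometric_bound_of_hasSum hq1 hb hsum' N
  rw [norm_sub_rev]
  refine h.trans ?_
  calc ‖f‖ * (1 - ρ) ^ (-α) * q ^ N / (1 - q) = ‖f‖ * A * q ^ N := by rw [hA]; ring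
    _ ≤ ‖f‖ * A * (ε / A) :=
        mul_le_mul_of_nonneg_left hN.le (mul_nonneg (norm_nonneg f) hA0.le)
    _ = ε * ‖f‖ := by field_simp

/-- The identity of `𝒵^α` is approximated by uniformly bounded finite rank operators, uniformly
on compact subsets of the disk. -/
lemma exists_isCompactOperator_close (hα : 0 < α) {s : ℝ} (hs : s < 1) {ε : ℝ} (hε : 0 < ε) :
    ∃ P : ZygmundSpace α →L[ℂ] ZygmundSpace α, IsCompactOperator P ∧ ∀ f,
      (f - P f) 0 = 0 ∧ deriv (f - P f) 0 = 0 ∧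
      (∀ z ∈ unitDisk, stdWeight α z * ‖deriv (deriv (f - P f)) z‖ ≤ 3 * ‖f‖) ∧
      ∀ z : ℂ, ‖z‖ ≤ s → ‖deriv (deriv (f - P f)) z‖ ≤ ε * ‖f‖ := by
  obtain ⟨r, hr0, hr1, hr⟩ := exists_dilation_close hα hs (half_pos hε)
  -- The tolerance `1` controls the truncation error on the whole disk; with one `‖f‖` each for
  -- `f''` and its dilate this gives the factor `3`. The tolerance `ε / 2` serves the estimate on
  -- `|z| ≤ s`.
  obtain ⟨N, hN⟩ := exists_taylor_close hα hr0 hr1 (lt_min (half_pos hε) one_pos)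
  obtain ⟨P, hP, h⟩ := exists_isCompactOperator_deriv_deriv_eq hα (fun n => (r : ℂ) ^ n) N
  refine ⟨P, hP, fun f => ⟨(h f).1, (h f).2.1, fun z hz => ?_, fun z hz => ?_⟩⟩
  · rw [(h f).2.2 z hz]
    have hrz : ‖(r : ℂ) * z‖ = r * ‖z‖ := by
      rw [norm_mul, Complex.norm_real, Real.norm_of_nonneg hr0.le]
    have hz1 := norm_lt_one_of_mem hz
    have hrz1 : ‖(r : ℂ) * z‖ ≤ ‖z‖ := by rw [hrz]; nlinarith [norm_nonneg z]
    have hrzD : (r : ℂ) * z ∈ unitDisk := mem_unitDisk_of_norm_lt (hrz1.trans_lt hz1)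
    have h1 := f.weight_mul_le_norm hz
    have h2 := f.weight_mul_le_norm hrzD
    have h3 := (hN f z hz).trans (mul_le_mul_of_nonneg_right (min_le_right _ _) (norm_nonneg f))
    have h4 : stdWeight α z ≤ stdWeight α (r * z) := stdWeight_le_rpow_of_le hα hz (by
      nlinarith [norm_nonneg (r * z), norm_nonneg z])
    have h5 := stdWeight_nonneg α hz
    have h6 := stdWeight_le_one hα hz
    set S := ∑ n ∈ Finset.range N, (r : ℂ) ^ n * coeff n f * z ^ n
    have h7 : ‖deriv (deriv f) z - S‖ ≤ ‖deriv (deriv f) z‖ + ‖deriv (deriv f) (r * z)‖ +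
        ‖deriv (deriv f) (r * z) - S‖ := by
      have e : deriv (deriv f) z - S = deriv (deriv f) z - deriv (deriv f) (r * z) +
        (deriv (deriv f) (r * z) - S) := by ring
      rw [e]
      linarith [norm_add_le (deriv (deriv f) z - deriv (deriv f) (r * z))
        (deriv (deriv f) (r * z) - S), norm_sub_le (deriv (deriv f) z) (deriv (deriv f) (r * z))]
    have h8 := mul_le_mul_of_nonneg_left h7 h5
    have h9 := mul_le_mul_of_nonneg_right h4 (norm_nonneg (deriv (deriv f) (r * z)))
    have h10 := mul_le_mul h6 h3 (norm_nonneg _) zero_le_one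
    rw [mul_add, mul_add] at h8
    linarith
  · have hzD := mem_unitDisk_of_norm_lt (hz.trans_lt hs)
    rw [(h f).2.2 z hzD]
    have h1 := hr f z hz
    have h3 := (hN f z hzD).trans (mul_le_mul_of_nonneg_right (min_le_left _ _) (norm_nonneg f))
    have e := norm_sub_le_norm_sub_add_norm_sub (deriv (deriv f) z) (deriv (deriv f) (r * z))
      (∑ n ∈ Finset.range N, (r : ℂ) ^ n * coeff n f * z ^ n)
    linarith

end ZygmundSpace

/-! ### The operator, its symbols, and the reduction to boundary estimates. -/

/-- The coefficient of `f'' ∘ φ` in `(C_φ V_g f)''`. -/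
def symbolTwo (φ g : ℂ → ℂ) (z : ℂ) : ℂ := g (φ z) * deriv φ z ^ 2

/-- The coefficient of `f' ∘ φ` in `(C_φ V_g f)''`. -/
def symbolOne (φ g : ℂ → ℂ) (z : ℂ) : ℂ :=
  deriv g (φ z) * deriv φ z ^ 2 + g (φ z) * deriv (deriv φ) z

/-- On the disk the segment integral is the primitive of `f' g` that vanishes at `0`. -/
lemma hasDerivAt_volterraV {f g : ℂ → ℂ} (hf : DifferentiableOn ℂ f unitDisk)
    (hg : DifferentiableOn ℂ g unitDisk) {z : ℂ} (hz : z ∈ unitDisk) :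
    HasDerivAt (volterraV g f) (deriv f z * g z) z := by
  have hF : DifferentiableOn ℂ (fun ζ => deriv f ζ * g ζ) unitDisk :=
    (hf.deriv Metric.isOpen_ball).mul hg
  obtain ⟨G, hG0, hG⟩ := hF.isExactOn_ball.with_val_at 0 0
  refine (hG z hz).congr_of_eventuallyEq ?_
  filter_upwards [unitDisk_mem_nhds hz] with ζ hζ
  have hmem : ∀ t ∈ Set.uIcc (0 : ℝ) 1, (t : ℂ) * ζ ∈ unitDisk := fun t ht => by
    rw [Set.uIcc_of_le zero_le_one] at ht
    refine mem_unitDisk_of_norm_lt ?_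
    rw [norm_mul, Complex.norm_real, Real.norm_of_nonneg ht.1]
    nlinarith [norm_nonneg ζ, norm_lt_one_of_mem hζ, ht.2]
  have hline : ∀ t : ℝ, HasDerivAt (fun t : ℝ => (t : ℂ) * ζ) ζ t := fun t => by
    simpa using (Complex.ofRealCLM.hasDerivAt (x := t)).mul_const ζ
  have hd : ∀ t ∈ Set.uIcc (0 : ℝ) 1, HasDerivAt (fun t : ℝ => G (t * ζ))
      (deriv f (t * ζ) * g (t * ζ) * ζ) t := fun t ht =>
    HasDerivAt.comp t (hG _ (hmem t ht)) (hline t)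
  have hc : ContinuousOn (fun t : ℝ => deriv f (t * ζ) * g (t * ζ) * ζ) (Set.uIcc (0 : ℝ) 1) :=
    (hF.continuousOn.comp (fun t _ => (hline t).continuousAt.continuousWithinAt) hmem).mul
      continuousOn_const
  have h := intervalIntegral.integral_eq_sub_of_hasDerivAt hd hc.intervalIntegrable
  rw [volterraV, h]
  simp [hG0]

section Operator

variable {α β : ℝ} {φ g : ℂ → ℂ} (hφ : DifferentiableOn ℂ φ unitDisk)
  (hφD : Set.MapsTo φ unitDisk unitDisk) (hg : DifferentiableOn ℂ g unitDisk)
  {T : ZygmundSpace α →L[ℂ] ZygmundSpace β}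
  (hT : ∀ f : ZygmundSpace α, ∀ z ∈ unitDisk, T f z = compVolterraV φ g f z)

include hφ hφD hg hT

lemma deriv_compVolterra_apply (f : ZygmundSpace α) {z : ℂ} (hz : z ∈ unitDisk) :
    deriv (T f) z = deriv f (φ z) * g (φ z) * deriv φ z := by
  have h : Set.EqOn (T f) (compVolterraV φ g f) unitDisk := hT f
  rw [h.deriv Metric.isOpen_ball hz]
  exact ((hasDerivAt_volterraV f.differentiableOn hg (hφD hz)).comp z
    (hφ.differentiableAt (unitDisk_mem_nhds hz)).hasDerivAt).deriv

/-- The identity from which all later estimates of `T` are read off. -/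
lemma deriv_deriv_compVolterra_apply (f : ZygmundSpace α) {z : ℂ} (hz : z ∈ unitDisk) :
    deriv (deriv (T f)) z =
      deriv (deriv f) (φ z) * symbolTwo φ g z + deriv f (φ z) * symbolOne φ g z := by
  have h : Set.EqOn (deriv (T f)) (fun z => deriv f (φ z) * g (φ z) * deriv φ z) unitDisk :=
    fun z hz => deriv_compVolterra_apply hφ hφD hg hT f hz
  rw [h.deriv Metric.isOpen_ball hz]
  have hn := unitDisk_mem_nhds hz
  have hφz := (hφ.differentiableAt hn).hasDerivAt
  have hφz' := ((hφ.deriv Metric.isOpen_ball).differentiableAt hn).hasDerivAt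
  have hnφ := unitDisk_mem_nhds (hφD hz)
  have hgz := (hg.differentiableAt hnφ).hasDerivAt.comp z hφz
  have hfz := (f.differentiableOn_deriv.differentiableAt hnφ).hasDerivAt.comp z hφz
  refine ((hfz.mul hgz).mul hφz').deriv.trans ?_
  simp only [symbolTwo, symbolOne, Function.comp_apply, Pi.mul_apply]
  ring

/-- Test on `f(z) = z`, for which `(T f)'' = w`. -/
lemma exists_symbolOne_bound :
    ∃ B, 0 ≤ B ∧ ∀ z ∈ unitDisk, stdWeight β z * ‖symbolOne φ g z‖ ≤ B := by
  obtain ⟨d, -, hd1, hd2⟩ := ZygmundSpace.exists_identity (α := α)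
  refine ⟨‖T d‖, norm_nonneg _, fun z hz => ?_⟩
  have h := (T d).weight_mul_le_norm hz
  rwa [deriv_deriv_compVolterra_apply hφ hφD hg hT d hz, hd1 _ (hφD hz), hd2 _ (hφD hz), zero_mul,
    zero_add, one_mul] at h

/-- Test on `f(z) = z² / 2`, for which `(T f)'' = u + φ w`, and remove `φ w` by the bound for `w`.
-/
lemma exists_symbolTwo_bound (hα : 0 < α) :
    ∃ B, 0 ≤ B ∧ ∀ z ∈ unitDisk, stdWeight β z * ‖symbolTwo φ g z‖ ≤ B := by
  obtain ⟨B, hB0, hB⟩ := exists_symbolOne_bound hφ hφD hg hT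
  obtain ⟨m, -, -, hm1, hm2⟩ := ZygmundSpace.exists_monomial hα 0
  refine ⟨‖T m‖ + B, add_nonneg (norm_nonneg _) hB0, fun z hz => ?_⟩
  have h := (T m).weight_mul_le_norm hz
  rw [deriv_deriv_compVolterra_apply hφ hφD hg hT m hz, hm1 _ (hφD hz), hm2 _ (hφD hz)] at h
  have h0 := hB z hz
  have hv := stdWeight_nonneg β hz
  have h1 : ‖symbolTwo φ g z‖ ≤ ‖φ z ^ 0 * symbolTwo φ g z +
      φ z ^ (0 + 1) / ((0 : ℕ) + 1) * symbolOne φ g z‖ + ‖symbolOne φ g z‖ := by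
    have e : symbolTwo φ g z = (φ z ^ 0 * symbolTwo φ g z +
      φ z ^ (0 + 1) / ((0 : ℕ) + 1) * symbolOne φ g z) - φ z * symbolOne φ g z := by
      simp
    have h2 : ‖φ z * symbolOne φ g z‖ ≤ ‖symbolOne φ g z‖ := by
      rw [norm_mul]
      exact mul_le_of_le_one_left (norm_nonneg _) (norm_lt_one_of_mem (hφD hz)).le
    calc ‖symbolTwo φ g z‖ = _ := congrArg norm e
      _ ≤ _ := norm_sub_le _ _
      _ ≤ _ := add_le_add le_rfl h2
  have h3 := mul_le_mul_of_nonneg_left h1 hv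
  rw [mul_add] at h3
  linarith

omit hφ hφD hg hT in
-- `-T P` is a compact competitor in the infimum.
lemma essentialNorm_le_norm_sub_comp {X Y : Type*} [NormedAddCommGroup X] [NormedSpace ℂ X]
    [NormedAddCommGroup Y] [NormedSpace ℂ Y] (T : X →L[ℂ] Y) {P : X →L[ℂ] X}
    (hP : IsCompactOperator P) {C : ℝ} (hC0 : 0 ≤ C) (hC : ∀ f, ‖T (f - P f)‖ ≤ C * ‖f‖) :
    essentialNorm T ≤ ENNReal.ofReal C := by
  have hK : IsCompactOperator (-(T.comp P) : X →L[ℂ] Y) := (hP.clm_comp T).neg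
  refine (iInf₂_le (f := fun (K : X →L[ℂ] Y) (_ : IsCompactOperator K) => ‖T + K‖ₑ) _ hK).trans ?_
  rw [← ofReal_norm]
  refine ENNReal.ofReal_le_ofReal (ContinuousLinearMap.opNorm_le_bound _ hC0 fun f => ?_)
  have e : (T + -(T.comp P)) f = T (f - P f) := by simp [sub_eq_add_neg]
  rw [e]
  exact hC f

/-- For `h = f - P f`, whatever depends on `h` over a compact part of the disk costs an arbitrarily
small amount; only the points with `|φ z| > s` remain. The `u`-term there gives `3 B₁`. The `w`-term
is left as a hypothesis on `h`, since the admissible growth of `h'` depends on whether `α` is below,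
equal to or above `1`. -/
lemma essentialNorm_le_of_boundary_bound (hα : 0 < α) {s δ B₁ B₂ : ℝ} (hs : s < 1)
    (hδ : 0 < δ) (hB₁0 : 0 ≤ B₁) (hB₂0 : 0 ≤ B₂)
    (hB₁ : ∀ z ∈ unitDisk, s < ‖φ z‖ →
      stdWeight β z * ‖symbolTwo φ g z‖ ≤ B₁ * stdWeight α (φ z))
    (hB₂ : ∀ h : ZygmundSpace α, ∀ M, 0 ≤ M → deriv h 0 = 0 →
      (∀ ζ ∈ unitDisk, stdWeight α ζ * ‖deriv (deriv h) ζ‖ ≤ 3 * M) →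
      (∀ ζ, ‖ζ‖ ≤ s → ‖deriv h ζ‖ ≤ δ * M) →
      ∀ z ∈ unitDisk, s < ‖φ z‖ →
        stdWeight β z * ‖symbolOne φ g z‖ * ‖deriv h (φ z)‖ ≤ B₂ * M) :
    essentialNorm T ≤ ENNReal.ofReal (3 * B₁ + B₂) := by
  obtain ⟨W, hW0, hW⟩ := exists_symbolOne_bound hφ hφD hg hT
  obtain ⟨U, hU0, hU⟩ := exists_symbolTwo_bound hφ hφD hg hT hα
  have h0D := ZygmundSpace.zero_mem_unitDisk
  -- `φ 0` is included because the norm of `T h` also involves `T h 0` and `(T h)'(0)`, which see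
  -- `h'` on the segment up to `φ 0`.
  set r := max s ‖φ 0‖ with hr
  have hr0 : 0 ≤ r := (norm_nonneg _).trans (le_max_right _ _)
  have hr1 : r < 1 := max_lt hs (norm_lt_one_of_mem (hφD h0D))
  have hsub : Metric.closedBall (0 : ℂ) r ⊆ unitDisk := Metric.closedBall_subset_ball hr1
  obtain ⟨G, hG⟩ := (isCompact_closedBall (0 : ℂ) r).exists_bound_of_continuousOn
    (hg.continuousOn.mono hsub)
  have hG0 : 0 ≤ G := (norm_nonneg _).trans (hG 0 (by simpa using hr0))
  -- The total coefficient of `ε ‖f‖`: value at `0`, derivative at `0`, and both symbols over `|φ z|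
  -- ≤ s`.
  set A := G + G * ‖deriv φ 0‖ + U + W with hA
  have hA0 : 0 ≤ A := by positivity
  refine ENNReal.le_of_forall_pos_le_add fun η hη _ => ?_
  have hη' : (0 : ℝ) < η := hη
  set ε := min δ (η / (A + 1)) with hε
  have hε0 : 0 < ε := lt_min hδ (by positivity)
  have hεA : ε * A ≤ η := by
    have : ε ≤ η / (A + 1) := min_le_right _ _
    rw [le_div_iff₀ (by positivity)] at this
    linarith
  obtain ⟨P, hP, hPf⟩ := ZygmundSpace.exists_isCompactOperator_close hα hr1 hε0
  rw [← ENNReal.ofReal_coe_nnreal, ← ENNReal.ofReal_add (by positivity) (NNReal.coe_nonneg η)]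
  refine essentialNorm_le_norm_sub_comp T hP (by positivity) fun f => ?_
  obtain ⟨-, hh1, hh2, hhs⟩ := hPf f
  set h := f - P f
  set N := ‖f‖
  have hN0 : 0 ≤ N := norm_nonneg f
  have hhd : ∀ ζ, ‖ζ‖ ≤ r → ‖deriv h ζ‖ ≤ ε * N := fun ζ hζ => by
    have hmv := (convex_closedBall (0 : ℂ) r).norm_image_sub_le_of_norm_deriv_le
      (f := deriv h) (x := 0) (y := ζ)
      (fun x hx => h.differentiableOn_deriv.differentiableAt (unitDisk_mem_nhds (hsub hx)))
      (fun x hx => hhs x (by simpa using hx)) (by simpa using hr0) (by simpa using hζ)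
    rw [hh1, sub_zero, sub_zero] at hmv
    exact hmv.trans (mul_le_of_le_one_right (by positivity) (hζ.trans hr1.le))
  have hT0 : ‖T h 0‖ ≤ G * (ε * N) := by
    rw [hT h 0 h0D, compVolterraV, volterraV]
    have hφ0 : ‖φ 0‖ ≤ r := le_max_right _ _
    have hint := intervalIntegral.norm_integral_le_of_norm_le_const (a := 0) (b := 1)
      (f := fun t : ℝ => deriv h (t * φ 0) * g (t * φ 0) * φ 0) (C := G * (ε * N))
      fun t ht => by
        rw [Set.uIoc_of_le zero_le_one] at ht
        have ht' : ‖(t : ℂ) * φ 0‖ ≤ r := by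
          rw [norm_mul, Complex.norm_real, Real.norm_of_nonneg ht.1.le]
          nlinarith [norm_nonneg (φ 0), ht.2]
        rw [norm_mul, norm_mul]
        have h1 := hhd _ ht'
        have h2 := hG (t * φ 0) (by simpa using ht')
        have h3 : ‖φ 0‖ ≤ 1 := hφ0.trans hr1.le
        calc _ ≤ (ε * N) * G * 1 := by gcongr
          _ = _ := by ring
    simpa using hint
  have hT1 : ‖deriv (T h) 0‖ ≤ G * ‖deriv φ 0‖ * (ε * N) := by
    rw [deriv_compVolterra_apply hφ hφD hg hT h h0D, norm_mul, norm_mul]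
    have h0r : ‖φ 0‖ ≤ r := le_max_right _ _
    have h1 := hhd (φ 0) h0r
    have h2 := hG (φ 0) (by simpa using h0r)
    calc _ ≤ (ε * N) * G * ‖deriv φ 0‖ := by gcongr
      _ = _ := by ring
  have hT2 : ∀ z ∈ unitDisk, stdWeight β z * ‖deriv (deriv (T h)) z‖ ≤
      (U + W) * (ε * N) + (3 * B₁ + B₂) * N := fun z hz => by
    rw [deriv_deriv_compVolterra_apply hφ hφD hg hT h hz]
    have hv := stdWeight_nonneg β hz
    have hadd := mul_le_mul_of_nonneg_left (norm_add_le (deriv (deriv h) (φ z) * symbolTwo φ g z)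
      (deriv h (φ z) * symbolOne φ g z)) hv
    rw [norm_mul, norm_mul] at hadd
    refine hadd.trans ?_
    rcases le_or_gt ‖φ z‖ s with hz' | hz'
    · have hzr : ‖φ z‖ ≤ r := hz'.trans (le_max_left _ _)
      have h1 := mul_le_mul (hU z hz) (hhs _ hzr) (norm_nonneg _) hU0
      have h2 := mul_le_mul (hW z hz) (hhd _ hzr) (norm_nonneg _) hW0
      have h3 : 0 ≤ (3 * B₁ + B₂) * N := by positivity
      linarith
    · have h1 := mul_le_mul_of_nonneg_right (hB₁ z hz hz') (norm_nonneg (deriv (deriv h) (φ z)))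
      have h2 := mul_le_mul_of_nonneg_left (hh2 _ (hφD hz)) hB₁0
      have h3 := hB₂ h N hN0 hh1 hh2 (fun ζ hζ => (hhd ζ (hζ.trans (le_max_left _ _))).trans
        (mul_le_mul_of_nonneg_right (min_le_left _ _) hN0)) z hz hz'
      have h4 : 0 ≤ (U + W) * (ε * N) := by positivity
      linarith
  have hfin := (T h).norm_le_of_forall hT2
  have h5 : ε * A * N ≤ η * N := mul_le_mul_of_nonneg_right hεA hN0
  rw [hA] at h5
  nlinarith

end Operator

/-! ### Test functions concentrated near a boundary point. -/

/-- Points of the disk tending to the unit circle. -/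
def toCircle : Filter unitDisk := Filter.comap (fun a : unitDisk => ‖(a : ℂ)‖) (nhds 1)

lemma eventually_toCircle {p : unitDisk → Prop} :
    (∀ᶠ a in toCircle, p a) ↔ ∃ s < 1, ∀ a : unitDisk, s < ‖(a : ℂ)‖ → p a := by
  rw [toCircle, (Filter.HasBasis.comap _ (nhds_basis_Ioo (1 : ℝ))).eventually_iff]
  constructor
  · rintro ⟨⟨x, y⟩, ⟨hx, hy⟩, h⟩
    exact ⟨x, hx, fun a ha => h ⟨ha, (norm_lt_one_of_mem a.2).trans hy⟩⟩
  · rintro ⟨s, hs, h⟩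
    exact ⟨(s, 2), ⟨hs, one_lt_two⟩, fun a ha => h a ha.1⟩

lemma tendsto_one_sub_norm_sq_toCircle :
    Filter.Tendsto (fun a : unitDisk => 1 - ‖(a : ℂ)‖ ^ 2) toCircle (nhds 0) := by
  have h : Filter.Tendsto (fun a : unitDisk => ‖(a : ℂ)‖) toCircle (nhds 1) :=
    Filter.tendsto_comap
  simpa using (h.pow 2).const_sub 1

lemma one_sub_norm_sq_pos {a : ℂ} (ha : a ∈ unitDisk) : 0 < 1 - ‖a‖ ^ 2 := by
  have := norm_lt_one_of_mem ha
  nlinarith [norm_nonneg a]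

namespace ZygmundSpace

variable {α : ℝ}

lemma mem_little_of_bounded (hα : 0 < α) {f : ZygmundSpace α} {C : ℝ}
    (hC : ∀ z ∈ unitDisk, ‖deriv (deriv f) z‖ ≤ C) : f ∈ little α := by
  intro ε hε
  have h1 : Filter.Tendsto (fun a : unitDisk => (1 - ‖(a : ℂ)‖ ^ 2) ^ α * C) toCircle
      (nhds 0) := by
    have := (tendsto_one_sub_norm_sq_toCircle.rpow_const (p := α) (Or.inr hα.le)).mul_const C
    rwa [Real.zero_rpow hα.ne', zero_mul] at this
  obtain ⟨r, hr, h⟩ := eventually_toCircle.1 (h1.eventually (gt_mem_nhds hε))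
  exact ⟨r, hr, fun z hz hrz => (mul_le_mul_of_nonneg_left (hC z hz)
    (stdWeight_nonneg α hz)).trans (h ⟨z, hz⟩ hrz).le⟩

/-- Three kinds of bounds on `F a` are needed: a weighted one uniform in `a` for the norm, an
unweighted one that may depend on `a` for the little space, and the factor `e a` for locally uniform
decay. -/
lemma exists_isNullFamily (hα : 0 < α) {F : unitDisk → ℂ → ℂ} {C : ℝ}
    (hF : ∀ a, DifferentiableOn ℂ (F a) unitDisk) (hF0 : ∀ a, ‖F a 0‖ ≤ 1)
    (hC : ∀ a, ∀ z ∈ unitDisk, stdWeight α z * ‖deriv (F a) z‖ ≤ C)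
    (hb : ∀ a, ∃ B, ∀ z ∈ unitDisk, ‖deriv (F a) z‖ ≤ B)
    {e : unitDisk → ℝ} (he : Filter.Tendsto e toCircle (nhds 0)) (he0 : ∀ a, ‖F a 0‖ ≤ e a)
    (her : ∀ r < 1, ∃ B, ∀ a, ∀ z : ℂ, ‖z‖ ≤ r → ‖deriv (F a) z‖ ≤ B * e a) :
    ∃ f : unitDisk → ZygmundSpace α, IsNullFamily toCircle f (1 + C) ∧
      ∀ a, ∀ z ∈ unitDisk, deriv (f a) z = F a z ∧ deriv (deriv (f a)) z = deriv (F a) z := by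
  choose f hf0 hf1 hf2 hfn using fun a => exists_deriv_eqOn (hF a) (hC a)
  refine ⟨f, ⟨fun a => ?_, fun a => (hfn a).trans (add_le_add (hF0 a) le_rfl), hf0, ?_, ?_⟩,
    fun a z hz => ⟨hf1 a hz, hf2 a hz⟩⟩
  · obtain ⟨B, hB⟩ := hb a
    exact mem_little_of_bounded hα (C := B) fun z hz => by rw [hf2 a hz]; exact hB z hz
  · intro ε hε
    filter_upwards [he.eventually (gt_mem_nhds hε)] with a ha
    rw [hf1 a zero_mem_unitDisk]
    exact (he0 a).trans ha.le
  · intro r hr ε hε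
    obtain ⟨B, hB⟩ := her r hr
    have h := he.const_mul B
    rw [mul_zero] at h
    filter_upwards [h.eventually (gt_mem_nhds hε)] with a ha z hz
    rw [hf2 a (mem_unitDisk_of_norm_lt (hz.trans_lt hr))]
    exact (hB a z hz).trans ha.le

section Kernel

variable {a z : ℂ}

lemma norm_conj_mul_le (ha : a ∈ unitDisk) : ‖conj a * z‖ ≤ ‖z‖ := by
  rw [norm_mul, RCLike.norm_conj]
  exact mul_le_of_le_one_left (norm_nonneg z) (norm_lt_one_of_mem ha).le

lemma one_sub_norm_right_le (ha : a ∈ unitDisk) : 1 - ‖z‖ ≤ ‖1 - conj a * z‖ := by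
  have h := norm_sub_norm_le (1 : ℂ) (conj a * z)
  rw [norm_one] at h
  linarith [norm_conj_mul_le (z := z) ha]

lemma one_sub_norm_left_le (hz : z ∈ unitDisk) : 1 - ‖a‖ ≤ ‖1 - conj a * z‖ := by
  have h := norm_sub_norm_le (1 : ℂ) (conj a * z)
  rw [norm_one, norm_mul, RCLike.norm_conj] at h
  nlinarith [norm_nonneg a, norm_lt_one_of_mem hz]

lemma norm_kernel_pos (ha : a ∈ unitDisk) (hz : z ∈ unitDisk) : 0 < ‖1 - conj a * z‖ := by
  linarith [one_sub_norm_right_le (z := z) ha, norm_lt_one_of_mem hz]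

lemma one_sub_sq_right_le (ha : a ∈ unitDisk) (hz : z ∈ unitDisk) :
    1 - ‖z‖ ^ 2 ≤ 2 * ‖1 - conj a * z‖ := by
  nlinarith [one_sub_norm_right_le (z := z) ha, norm_lt_one_of_mem hz, norm_nonneg z]

lemma one_sub_sq_left_le (ha : a ∈ unitDisk) (hz : z ∈ unitDisk) :
    1 - ‖a‖ ^ 2 ≤ 2 * ‖1 - conj a * z‖ := by
  nlinarith [one_sub_norm_left_le (a := a) hz, norm_lt_one_of_mem ha, norm_nonneg a]

lemma hasDerivAt_kernel (a z : ℂ) : HasDerivAt (fun z => 1 - conj a * z) (-conj a) z := by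
  simpa using ((hasDerivAt_id z).const_mul (conj a)).const_sub 1

lemma kernel_self (a : ℂ) : 1 - conj a * a = ((1 - ‖a‖ ^ 2 : ℝ) : ℂ) := by
  rw [Complex.conj_mul']
  push_cast
  rfl

end Kernel

/-- Take `f' = (1 - |a|²)^(m + 1 - α) (1 - ā z)^(-m)`. Both `1 - |z|²` and `1 - |a|²` are at most `2
|1 - ā z|`, so the powers cancel in the weighted norm of `f''`; the condition `α < m + 1` gives
decay away from the circle. At `z = a` the value of `f'` does not depend on `m`, while `f''` is
proportional to `m`, so two values of `m` can be combined to cancel `f'`. -/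
lemma exists_power_family (hα : 0 < α) {m : ℕ} (hm : α < m + 1) :
    ∃ f : unitDisk → ZygmundSpace α, IsNullFamily toCircle f (1 + m * 2 ^ (m + 1)) ∧
      ∀ a : unitDisk, deriv (f a) a = ((1 - ‖(a : ℂ)‖ ^ 2) ^ (1 - α) : ℝ) ∧
        deriv (deriv (f a)) a = m * conj (a : ℂ) * ((1 - ‖(a : ℂ)‖ ^ 2) ^ (-α) : ℝ) := by
  let e : unitDisk → ℝ := fun a => (1 - ‖(a : ℂ)‖ ^ 2) ^ (m + 1 - α)
  have he0 : ∀ a, 0 ≤ e a := fun a => Real.rpow_nonneg (one_sub_norm_sq_pos a.2).le _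
  let F : unitDisk → ℂ → ℂ := fun a z => (e a : ℂ) * ((1 - conj (a : ℂ) * z) ^ m)⁻¹
  have hd : ∀ a : unitDisk, ∀ z ∈ unitDisk, HasDerivAt (F a)
      ((e a : ℂ) * (m * conj (a : ℂ) * ((1 - conj (a : ℂ) * z) ^ (m + 1))⁻¹)) z := by
    intro a z hz
    have h0 : 1 - conj (a : ℂ) * z ≠ 0 := norm_pos_iff.1 (norm_kernel_pos a.2 hz)
    have h1 := (((hasDerivAt_kernel a z).pow m).inv (pow_ne_zero m h0)).const_mul (e a : ℂ)
    refine h1.congr_deriv ?_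
    rcases m with _ | m
    · simp
    · simp only [Nat.add_sub_cancel, Pi.pow_apply]
      field_simp
      ring
  -- The lower bound `x` is left free: it becomes `|1 - ā z|` for the norm, `1 - |a|` for fixed `a`,
  -- and `1 - r` on compact sets.
  have hn : ∀ a : unitDisk, ∀ z ∈ unitDisk, ∀ x > 0, x ≤ ‖1 - conj (a : ℂ) * z‖ →
      ‖deriv (F a) z‖ ≤ m / x ^ (m + 1) * e a := by
    intro a z hz x hx hxz
    rw [(hd a z hz).deriv, norm_mul, norm_mul, norm_mul, norm_inv, norm_pow, Complex.norm_real,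
      Real.norm_of_nonneg (he0 a), RCLike.norm_conj, Complex.norm_natCast]
    have h1 : ‖(a : ℂ)‖ ≤ 1 := (norm_lt_one_of_mem a.2).le
    calc e a * (m * ‖(a : ℂ)‖ * (‖1 - conj (a : ℂ) * z‖ ^ (m + 1))⁻¹)
        ≤ e a * (m * 1 * (x ^ (m + 1))⁻¹) := by
          have := he0 a
          gcongr
      _ = _ := by ring
  obtain ⟨f, hf, hfd⟩ := exists_isNullFamily (F := F) (C := m * 2 ^ (m + 1)) (e := e) hα
    (fun a z hz => (hd a z hz).differentiableAt.differentiableWithinAt)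
    (fun a => by
      have h1 : e a ≤ 1 := Real.rpow_le_one (one_sub_norm_sq_pos a.2).le
        (by nlinarith [norm_nonneg (a : ℂ)]) (by linarith)
      simpa [F, abs_of_nonneg (he0 a)] using h1)
    (fun a z hz => by
      set d := ‖1 - conj (a : ℂ) * z‖ with hd'
      have hd0 : 0 < d := norm_kernel_pos a.2 hz
      have h1 := hn a z hz d hd0 le_rfl
      have h2 : stdWeight α z ≤ (2 * d) ^ α :=
        stdWeight_le_rpow_of_le hα hz (one_sub_sq_right_le a.2 hz)
      have h3 : e a ≤ (2 * d) ^ ((m : ℝ) + 1 - α) :=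
        Real.rpow_le_rpow (one_sub_norm_sq_pos a.2).le (one_sub_sq_left_le a.2 hz) (by linarith)
      have h4 : (2 * d) ^ α * (2 * d) ^ ((m : ℝ) + 1 - α) = (2 * d) ^ (m + 1) := by
        rw [← Real.rpow_add (by positivity), ← Real.rpow_natCast]
        congr 1; push_cast; ring
      calc stdWeight α z * ‖deriv (F a) z‖
          ≤ (2 * d) ^ α * (m / d ^ (m + 1) * (2 * d) ^ ((m : ℝ) + 1 - α)) := by
            gcongr
            exact h1.trans (by gcongr)
        _ = m / d ^ (m + 1) * ((2 * d) ^ α * (2 * d) ^ ((m : ℝ) + 1 - α)) := by ring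
        _ = m * 2 ^ (m + 1) := by rw [h4, mul_pow]; field_simp)
    (fun a => ⟨_, fun z hz => hn a z hz (1 - ‖(a : ℂ)‖)
      (by linarith [norm_lt_one_of_mem a.2]) (one_sub_norm_left_le hz)⟩)
    (by
      have h := tendsto_one_sub_norm_sq_toCircle.rpow_const (p := m + 1 - α) (Or.inr (by linarith))
      rwa [Real.zero_rpow (by linarith)] at h)
    (fun a => by simp [F, abs_of_nonneg (he0 a)])
    (fun r hr => ⟨m / (1 - r) ^ (m + 1), fun a z hz =>
      hn a z (mem_unitDisk_of_norm_lt (hz.trans_lt hr)) (1 - r) (by linarith)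
        (by linarith [one_sub_norm_right_le (z := z) a.2])⟩)
  refine ⟨f, hf, fun a => ⟨(hfd a a a.2).1.trans ?_, (hfd a a a.2).2.trans ?_⟩⟩
  · have h0 := one_sub_norm_sq_pos a.2
    simp only [F, e]
    rw [kernel_self, ← Complex.ofReal_pow, ← Complex.ofReal_inv, ← Complex.ofReal_mul]
    congr 1
    rw [← Real.rpow_natCast _ m, ← Real.rpow_neg h0.le, ← Real.rpow_add h0]
    congr 1; ring
  · have h0 := one_sub_norm_sq_pos a.2
    rw [(hd a a a.2).deriv, kernel_self, ← Complex.ofReal_pow, ← Complex.ofReal_inv,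
      mul_left_comm, ← Complex.ofReal_mul]
    congr 2
    simp only [e]
    rw [← Real.rpow_natCast _ (m + 1), ← Real.rpow_neg h0.le, ← Real.rpow_add h0]
    congr 1; push_cast; ring

/-- For `α = 1` the power families have `f'(a) = 1`, which does not see the logarithm. Here `f' = (1
- log (1 - ā z))² / l(a)` with `l(a) = 1 - log (1 - |a|²)`: the square leaves one factor `l(a)` at
`z = a`, and the denominator makes the family tend to `0` locally uniformly. The added `1` keeps
`l(a) ≥ 1`. -/
lemma exists_log_family :
    ∃ f : unitDisk → ZygmundSpace 1, IsNullFamily toCircle f (1 + 48) ∧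
      ∀ a : unitDisk, deriv (f a) a = (1 - Real.log (1 - ‖(a : ℂ)‖ ^ 2) : ℝ) ∧
        deriv (deriv (f a)) a = 2 * conj (a : ℂ) * ((1 - ‖(a : ℂ)‖ ^ 2)⁻¹ : ℝ) := by
  let l : unitDisk → ℝ := fun a => 1 - Real.log (1 - ‖(a : ℂ)‖ ^ 2)
  have hl : ∀ a, 1 ≤ l a := fun a => by
    have := Real.log_nonpos (one_sub_norm_sq_pos a.2).le (by nlinarith [norm_nonneg (a : ℂ)])
    simp only [l]; linarith
  have hl0 : ∀ a, 0 < l a := fun a => one_pos.trans_le (hl a)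
  let F : unitDisk → ℂ → ℂ := fun a z =>
    (1 - Complex.log (1 - conj (a : ℂ) * z)) ^ 2 / (l a : ℂ)
  have hd : ∀ a : unitDisk, ∀ z ∈ unitDisk, HasDerivAt (F a)
      (2 * (1 - Complex.log (1 - conj (a : ℂ) * z)) * conj (a : ℂ) /
        (1 - conj (a : ℂ) * z) / (l a : ℂ)) z := by
    intro a z hz
    have hs : 1 - conj (a : ℂ) * z ∈ Complex.slitPlane := by
      refine Or.inl ?_
      have h1 := Complex.re_le_norm (conj (a : ℂ) * z)
      have h2 := norm_conj_mul_le (z := z) a.2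
      have h3 := norm_lt_one_of_mem hz
      rw [Complex.sub_re, Complex.one_re]
      linarith
    have h1 := ((((hasDerivAt_kernel a z).clog hs).const_sub 1).pow 2).div_const (l a : ℂ)
    refine h1.congr_deriv ?_
    push_cast
    ring
  -- The constant `6` collects `1`, the bound `1 - log (x / 2)` for the real part of the logarithm,
  -- and `|arg| ≤ π < 4`, using `1 - log (x / 2) ≥ 1`.
  have hlog : ∀ a : unitDisk, ∀ z ∈ unitDisk, ∀ x, 0 < x → x ≤ 2 →
      x ≤ 2 * ‖1 - conj (a : ℂ) * z‖ →
      ‖1 - Complex.log (1 - conj (a : ℂ) * z)‖ ≤ 6 * (1 - Real.log (x / 2)) := by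
    intro a z hz x hx hx2 hxz
    set w := 1 - conj (a : ℂ) * z
    have hw0 : 0 < ‖w‖ := norm_kernel_pos a.2 hz
    have hw2 : ‖w‖ ≤ 2 := by
      have h1 := norm_sub_le (1 : ℂ) (conj (a : ℂ) * z)
      have h2 := norm_conj_mul_le (z := z) a.2
      have h3 := norm_lt_one_of_mem hz
      rw [norm_one] at h1
      linarith
    have h1 : ‖Complex.log w‖ ≤ |Real.log ‖w‖| + |Complex.arg w| := by
      have := Complex.norm_le_abs_re_add_abs_im (Complex.log w)
      rwa [Complex.log_re, Complex.log_im] at this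
    have h2 := Complex.abs_arg_le_pi w
    have h3 := Real.pi_lt_four
    have h4 : Real.log ‖w‖ ≤ 1 := (Real.log_le_log hw0 hw2).trans
      (by linarith [Real.log_two_lt_d9])
    have h5 : Real.log (x / 2) ≤ Real.log ‖w‖ := Real.log_le_log (by positivity) (by linarith)
    have h6 : Real.log (x / 2) ≤ 0 := Real.log_nonpos (by positivity) (by linarith)
    have h7 : |Real.log ‖w‖| ≤ 1 - Real.log (x / 2) := abs_le.2 ⟨by linarith, by linarith⟩
    have h8 := norm_sub_le 1 (Complex.log w)
    rw [norm_one] at h8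
    linarith
  have hlog' : ∀ a : unitDisk, ∀ z ∈ unitDisk,
      ‖1 - Complex.log (1 - conj (a : ℂ) * z)‖ ≤ 12 * l a := by
    intro a z hz
    have h0 := one_sub_norm_sq_pos a.2
    refine (hlog a z hz _ h0 (by nlinarith [norm_nonneg (a : ℂ)])
      (one_sub_sq_left_le a.2 hz)).trans ?_
    rw [Real.log_div h0.ne' two_ne_zero]
    have h1 : Real.log 2 ≤ 1 := by linarith [Real.log_two_lt_d9]
    have h2 := hl a
    simp only [l] at h2 ⊢
    linarith
  have hn : ∀ a : unitDisk, ∀ z ∈ unitDisk, ∀ x > 0, x ≤ ‖1 - conj (a : ℂ) * z‖ → ∀ y,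
      ‖1 - Complex.log (1 - conj (a : ℂ) * z)‖ ≤ y → ‖deriv (F a) z‖ ≤ 2 * y / x * (l a)⁻¹ := by
    intro a z hz x hx hxz y hy
    rw [(hd a z hz).deriv, norm_div, norm_div, norm_mul, norm_mul, Complex.norm_real,
      Real.norm_of_nonneg (hl0 a).le, RCLike.norm_conj, Complex.norm_ofNat, ← div_eq_mul_inv]
    have h1 : ‖(a : ℂ)‖ ≤ 1 := (norm_lt_one_of_mem a.2).le
    have h2 := hl0 a
    have hy0 : 0 ≤ y := (norm_nonneg _).trans hy
    rw [← mul_one (2 * y)]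
    gcongr
  obtain ⟨f, hf, hfd⟩ := exists_isNullFamily (F := F) (C := 48) (e := fun a => (l a)⁻¹) one_pos
    (fun a z hz => (hd a z hz).differentiableAt.differentiableWithinAt)
    (fun a => by
      simpa [F, abs_of_pos (hl0 a)] using inv_le_one_of_one_le₀ (hl a))
    (fun a z hz => by
      have hd0 := norm_kernel_pos a.2 hz
      have h1 := hn a z hz _ hd0 le_rfl _ (hlog' a z hz)
      have h2 := stdWeight_le_rpow_of_le one_pos hz (one_sub_sq_right_le a.2 hz)
      rw [Real.rpow_one] at h2
      have h3 := hl0 a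
      refine (mul_le_mul h2 h1 (norm_nonneg _) (by positivity)).trans_eq ?_
      field_simp
      norm_num)
    (fun a => ⟨_, fun z hz => hn a z hz (1 - ‖(a : ℂ)‖)
      (by linarith [norm_lt_one_of_mem a.2]) (one_sub_norm_left_le hz) _ (hlog' a z hz)⟩)
    (by
      refine Filter.Tendsto.inv_tendsto_atTop ?_
      have h : Filter.Tendsto (fun a : unitDisk => 1 - ‖(a : ℂ)‖ ^ 2) toCircle
          (nhdsWithin 0 (Set.Ioi 0)) :=
        tendsto_nhdsWithin_iff.2 ⟨tendsto_one_sub_norm_sq_toCircle,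
          Filter.Eventually.of_forall fun a => one_sub_norm_sq_pos a.2⟩
      have h1 := Filter.tendsto_neg_atBot_atTop.comp (Real.tendsto_log_nhdsGT_zero.comp h)
      exact (Filter.tendsto_atTop_add_const_left _ 1 h1).congr fun a => by
        simp [l, sub_eq_add_neg])
    (fun a => by simp [F, abs_of_pos (hl0 a)])
    (fun r hr => ⟨2 * (6 * (1 - Real.log ((1 - r) / 2))) / (1 - r), fun a z hz => by
      have hzD := mem_unitDisk_of_norm_lt (hz.trans_lt hr)
      have h1 := one_sub_norm_right_le (z := z) a.2
      have h2 := norm_nonneg z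
      exact hn a z hzD (1 - r) (by linarith) (by linarith) _
        (hlog a z hzD (1 - r) (by linarith) (by linarith) (by linarith))⟩)
  refine ⟨f, hf, fun a => ⟨(hfd a a a.2).1.trans ?_, (hfd a a a.2).2.trans ?_⟩⟩
  · have h0 := one_sub_norm_sq_pos a.2
    have h1 := (hl0 a).ne'
    simp only [F]
    rw [kernel_self, ← Complex.ofReal_log h0.le, ← Complex.ofReal_one, ← Complex.ofReal_sub,
      ← Complex.ofReal_pow, ← Complex.ofReal_div]
    congr 1
    change l a ^ 2 / l a = l a
    field_simp
  · have h0 := one_sub_norm_sq_pos a.2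
    have h1 : (l a : ℂ) ≠ 0 := Complex.ofReal_ne_zero.2 (hl0 a).ne'
    rw [(hd a a a.2).deriv, kernel_self, ← Complex.ofReal_log h0.le, ← Complex.ofReal_one,
      ← Complex.ofReal_sub]
    change 2 * (l a : ℂ) * conj (a : ℂ) / ((1 - ‖(a : ℂ)‖ ^ 2 : ℝ) : ℂ) / (l a : ℂ) = _
    rw [Complex.ofReal_inv]
    field_simp

end ZygmundSpace

/-! ### Comparison of powers `r ^ n` with boundary rates in `1 - r`. -/

section Scalar

/-- With `x = 1 - r`, use `r^n ≤ exp (-n x)` and `(n + 1) x ≤ n x + 1 ≤ p exp ((n x + 1) / p)`;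
after raising to the power `p` the exponentials cancel up to `e`. -/
lemma add_one_rpow_mul_pow_le {p r : ℝ} (hp : 0 < p) (hr0 : 0 ≤ r) (hr1 : r < 1) (n : ℕ) :
    ((n : ℝ) + 1) ^ p * r ^ n ≤ Real.exp 1 * p ^ p * (1 - r) ^ (-p) := by
  set x := 1 - r with hx
  have hx0 : 0 < x := by linarith
  have hx1 : x ≤ 1 := by linarith
  have hn : (0 : ℝ) ≤ n := n.cast_nonneg
  have h1 : r ^ n ≤ Real.exp (-(n * x)) := by
    have : r ≤ Real.exp (-x) := by linarith [Real.add_one_le_exp (-x)]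
    calc r ^ n ≤ Real.exp (-x) ^ n := by gcongr
      _ = _ := by rw [← Real.exp_nat_mul]; ring_nf
  have h2 : ((n : ℝ) + 1) ^ p * x ^ p ≤ p ^ p * Real.exp (n * x + 1) := by
    have h3 : ((n : ℝ) + 1) * x ≤ p * Real.exp ((n * x + 1) / p) := by
      have h4 := Real.add_one_le_exp ((n * x + 1) / p)
      have h5 : (n * x + 1) / p * p = n * x + 1 := by field_simp
      nlinarith
    rw [← Real.mul_rpow (by positivity) hx0.le]
    refine (Real.rpow_le_rpow (by positivity) h3 hp.le).trans_eq ?_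
    rw [Real.mul_rpow hp.le (Real.exp_pos _).le, ← Real.exp_mul, div_mul_cancel₀ _ hp.ne']
  have h6 : x ^ p * x ^ (-p) = 1 := by
    rw [← Real.rpow_add hx0, add_neg_cancel, Real.rpow_zero]
  have h7 : 0 < x ^ (-p) := Real.rpow_pos_of_pos hx0 _
  calc ((n : ℝ) + 1) ^ p * r ^ n
      ≤ ((n : ℝ) + 1) ^ p * Real.exp (-(n * x)) := by gcongr
    _ = (((n : ℝ) + 1) ^ p * x ^ p) * (Real.exp (-(n * x)) * x ^ (-p)) := by
        rw [show ∀ a b c d : ℝ, a * b * (c * d) = a * c * (b * d) by intros; ring, h6, mul_one]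
    _ ≤ (p ^ p * Real.exp (n * x + 1)) * (Real.exp (-(n * x)) * x ^ (-p)) := by gcongr
    _ = p ^ p * (Real.exp (n * x + 1) * Real.exp (-(n * x))) * x ^ (-p) := by ring
    _ = _ := by rw [← Real.exp_add]; ring_nf

/-- At the nearly optimal `n` one has `n (1 - r) ≤ 1`, and `1 / r ≤ exp (2 (1 - r))` when `r ≥ 1 /
2`. -/
lemma exp_neg_two_le_pow_floor {r : ℝ} (hr : 1 / 2 ≤ r) (hr1 : r < 1) :
    1 ≤ Real.exp 2 * r ^ ⌊1 / (1 - r)⌋₊ := by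
  have hr0 : 0 < r := by linarith
  have hx : 0 < 1 - r := by linarith
  set n := ⌊1 / (1 - r)⌋₊
  have hn : (n : ℝ) * (1 - r) ≤ 1 := by
    rw [← le_div_iff₀ hx]
    exact Nat.floor_le (by positivity)
  have h1 : r⁻¹ ≤ Real.exp (2 * (1 - r)) := by
    refine le_trans ?_ (Real.add_one_le_exp _)
    rw [inv_le_iff_one_le_mul₀ hr0]
    nlinarith
  have h2 : r⁻¹ ^ n ≤ Real.exp 2 := by
    calc r⁻¹ ^ n ≤ Real.exp (2 * (1 - r)) ^ n := by gcongr
      _ = Real.exp (n * (2 * (1 - r))) := by rw [← Real.exp_nat_mul]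
      _ ≤ Real.exp 2 := Real.exp_le_exp.2 (by linarith)
  rw [inv_pow] at h2
  rwa [inv_le_iff_one_le_mul₀ (by positivity)] at h2

lemma one_sub_rpow_neg_le {p r : ℝ} (hp : 0 < p) (hr : 1 / 2 ≤ r) (hr1 : r < 1) :
    (1 - r) ^ (-p) ≤ Real.exp 2 * (((⌊1 / (1 - r)⌋₊ : ℝ) + 1) ^ p * r ^ ⌊1 / (1 - r)⌋₊) := by
  have hx : 0 < 1 - r := by linarith
  have h1 : (1 - r) ^ (-p) ≤ ((⌊1 / (1 - r)⌋₊ : ℝ) + 1) ^ p := by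
    rw [Real.rpow_neg hx.le, ← Real.inv_rpow hx.le, ← one_div]
    exact Real.rpow_le_rpow (by positivity) (Nat.lt_floor_add_one _).le hp.le
  have h2 := exp_neg_two_le_pow_floor hr hr1
  have h3 : 0 ≤ ((⌊1 / (1 - r)⌋₊ : ℝ) + 1) ^ p := by positivity
  nlinarith

/-- Split `log n = log (n x) - log x` with `x = 1 - r`; the first part is absorbed by `n x exp (-n
x) ≤ 1`. -/
lemma log_nat_mul_pow_le {r : ℝ} (hr0 : 0 ≤ r) (hr1 : r < 1) (n : ℕ) :
    Real.log n * r ^ n ≤ 1 - Real.log (1 - r) := by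
  have hx : 0 < 1 - r := by linarith
  have hlog : Real.log (1 - r) ≤ 0 := Real.log_nonpos hx.le (by linarith)
  rcases n.eq_zero_or_pos with rfl | hn
  · simp; linarith
  have hn' : (0 : ℝ) < n := Nat.cast_pos.2 hn
  have h1 : Real.log n = Real.log (n * (1 - r)) - Real.log (1 - r) := by
    rw [Real.log_mul hn'.ne' hx.ne']; ring
  have h2 : Real.log (n * (1 - r)) ≤ n * (1 - r) := by
    linarith [Real.log_le_sub_one_of_pos (mul_pos hn' hx)]
  have h3 : r ^ n ≤ 1 := pow_le_one₀ hr0 hr1.le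
  have h4 : 0 ≤ r ^ n := by positivity
  have h5 : n * (1 - r) * r ^ n ≤ 1 := by
    have h6 : r ^ n ≤ Real.exp (-(n * (1 - r))) := by
      have : r ≤ Real.exp (-(1 - r)) := by linarith [Real.add_one_le_exp (-(1 - r))]
      calc r ^ n ≤ Real.exp (-(1 - r)) ^ n := by gcongr
        _ = _ := by rw [← Real.exp_nat_mul]; ring_nf
    have h7 := Real.add_one_le_exp (n * (1 - r))
    calc n * (1 - r) * r ^ n ≤ Real.exp (n * (1 - r)) * Real.exp (-(n * (1 - r))) := by
          gcongr; linarith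
      _ = 1 := by rw [← Real.exp_add]; simp
  rw [h1]
  nlinarith

/-- For `r ≥ 3 / 4` the integer `n` exceeds `3`, so `1 / (1 - r) < n + 1 ≤ n²`; this costs the
factor `2`. -/
lemma neg_log_one_sub_le {r : ℝ} (hr : 3 / 4 ≤ r) (hr1 : r < 1) :
    -Real.log (1 - r) ≤
      2 * Real.exp 2 * (Real.log ⌊1 / (1 - r)⌋₊ * r ^ ⌊1 / (1 - r)⌋₊) := by
  have hx : 0 < 1 - r := by linarith
  have h1 := exp_neg_two_le_pow_floor (by linarith) hr1
  set n := ⌊1 / (1 - r)⌋₊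
  have h2 : 1 / (1 - r) < n + 1 := Nat.lt_floor_add_one _
  have h4 : 4 ≤ 1 / (1 - r) := by rw [le_div_iff₀ hx]; linarith
  have h5 : Real.log (1 / (1 - r)) ≤ 2 * Real.log n := by
    rw [← Nat.cast_ofNat, ← Real.log_pow]
    refine Real.log_le_log (by positivity) ?_
    have : (3 : ℝ) < n := by linarith
    nlinarith
  rw [one_div, Real.log_inv] at h5
  have h6 : 0 ≤ Real.log n := Real.log_natCast_nonneg n
  nlinarith

/-- At a radius `t` between `s` and `1` the polynomial factor is already absorbed, and `(s / t)^n`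
tends to `0`. -/
lemma tendsto_add_one_rpow_mul_pow {p s : ℝ} (hp : 0 < p) (hs0 : 0 ≤ s) (hs1 : s < 1) :
    Filter.Tendsto (fun n : ℕ => ((n : ℝ) + 1) ^ p * s ^ n) Filter.atTop (nhds 0) := by
  set t := (1 + s) / 2 with ht
  have ht0 : 0 < t := by rw [ht]; linarith
  have ht1 : t < 1 := by rw [ht]; linarith
  have hst : s / t < 1 := by rw [div_lt_one ht0, ht]; linarith
  have h := (tendsto_pow_atTop_nhds_zero_of_lt_one (div_nonneg hs0 ht0.le) hst).const_mul
    (Real.exp 1 * p ^ p * (1 - t) ^ (-p))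
  rw [mul_zero] at h
  refine squeeze_zero (fun n => by positivity) (fun n => ?_) h
  have h1 := mul_le_mul_of_nonneg_right (add_one_rpow_mul_pow_le hp ht0.le ht1 n)
    (pow_nonneg (div_nonneg hs0 ht0.le) n)
  refine le_trans (le_of_eq ?_) h1
  rw [mul_assoc, ← mul_pow, mul_div_cancel₀ _ ht0.ne']

lemma one_sub_rpow_neg_le_sq {p r : ℝ} (hp : 0 ≤ p) (hr0 : 0 ≤ r) (hr1 : r < 1) :
    (1 - r) ^ (-p) ≤ 2 ^ p * (1 - r ^ 2) ^ (-p) := by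
  have h0 : 0 < 1 - r := by linarith
  have h1 : 0 < 1 - r ^ 2 := by nlinarith
  rw [Real.rpow_neg h0.le, Real.rpow_neg h1.le, ← div_eq_mul_inv, inv_le_iff_one_le_mul₀
    (Real.rpow_pos_of_pos h0 p), div_mul_eq_mul_div, le_div_iff₀ (Real.rpow_pos_of_pos h1 p),
    one_mul, ← Real.mul_rpow zero_le_two h0.le]
  exact Real.rpow_le_rpow h1.le (by nlinarith) hp

end Scalar

/-! ### Passage between limsups of weighted norms and boundary estimates. -/

section Limsup

variable {β : ℝ} {φ q : ℂ → ℂ} {c : ℕ → ℝ} {ω : ℂ → ℝ}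

/-- Points with `|φ z| ≤ s` contribute at most `c n * s ^ n * B`, which vanishes in the limit; at
the others `ω` dominates every `n` at once. -/
lemma limsupPow_le (hc : ∀ n, 0 ≤ c n) {A B X s : ℝ} (hA : 0 ≤ A) (hX0 : 0 ≤ X)
    (hs0 : 0 ≤ s)
    (hcs : Filter.Tendsto (fun n => c n * s ^ n) Filter.atTop (nhds 0))
    (hφD : Set.MapsTo φ unitDisk unitDisk)
    (hω : ∀ n, ∀ a ∈ unitDisk, c n * ‖a‖ ^ n ≤ A * ω a)
    (hB : ∀ z ∈ unitDisk, stdWeight β z * ‖q z‖ ≤ B)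
    (hX : ∀ z ∈ unitDisk, s < ‖φ z‖ → stdWeight β z * ‖q z‖ * ω (φ z) ≤ X) :
    limsupPow β (fun n => ENNReal.ofReal (c n)) q φ ≤ ENNReal.ofReal (A * X) := by
  refine ENNReal.le_of_forall_pos_le_add fun δ hδ _ => ?_
  have hδ' : (0 : ℝ) < δ := hδ
  rw [← ENNReal.ofReal_coe_nnreal, ← ENNReal.ofReal_add (by positivity) hδ'.le]
  have hcB := hcs.mul_const B
  rw [zero_mul] at hcB
  refine Filter.limsup_le_of_le (h := ?_)
  filter_upwards [hcB.eventually (gt_mem_nhds hδ')] with n hn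
  simp only [weightedNorm, ENNReal.mul_iSup]
  refine iSup₂_le fun z hz => ?_
  rw [← ENNReal.ofReal_mul (hc n)]
  refine ENNReal.ofReal_le_ofReal ?_
  have hv := stdWeight_nonneg β hz
  have hAX : 0 ≤ A * X := mul_nonneg hA hX0
  rw [norm_mul, norm_pow, show c n * (stdWeight β z * (‖q z‖ * ‖φ z‖ ^ n)) =
    (c n * ‖φ z‖ ^ n) * (stdWeight β z * ‖q z‖) by ring]
  have hq0 : 0 ≤ stdWeight β z * ‖q z‖ := by positivity
  rcases le_or_gt ‖φ z‖ s with h | h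
  · have h1 : c n * ‖φ z‖ ^ n ≤ c n * s ^ n := by
      have := hc n
      gcongr
    have h2 := mul_le_mul h1 (hB z hz) hq0 (mul_nonneg (hc n) (by positivity))
    linarith
  · have h1 := mul_le_mul_of_nonneg_right (hω n _ (hφD hz)) hq0
    have h2 := mul_le_mul_of_nonneg_left (hX z hz h) hA
    linarith

/-- At each `z` use the single index `n = ⌊1 / (1 - |φ z|)⌋`. It lies in the range where the terms
are below `R` once `|φ z| > 1 - 1 / (N + 1)`. -/
lemma exists_boundary_bound_of_limsupPow_lt (hc : ∀ n, 0 ≤ c n) {R κ s₀ : ℝ} (hR : 0 < R)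
    (hκ : 0 ≤ κ) (hs₀ : s₀ < 1) (hφD : Set.MapsTo φ unitDisk unitDisk)
    (hω : ∀ a ∈ unitDisk, s₀ < ‖a‖ →
      ω a ≤ κ * (c ⌊1 / (1 - ‖a‖)⌋₊ * ‖a‖ ^ ⌊1 / (1 - ‖a‖)⌋₊))
    (hlt : limsupPow β (fun n => ENNReal.ofReal (c n)) q φ < ENNReal.ofReal R) :
    ∃ s < 1, ∀ z ∈ unitDisk, s < ‖φ z‖ → stdWeight β z * ‖q z‖ * ω (φ z) ≤ κ * R := by
  obtain ⟨N, hN⟩ := Filter.eventually_atTop.1 (Filter.eventually_lt_of_limsup_lt hlt)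
  have hN1 : (0 : ℝ) < N + 1 := by positivity
  refine ⟨max s₀ (1 - 1 / (N + 1)), max_lt hs₀ (by linarith [one_div_pos.2 hN1]),
    fun z hz hsz => ?_⟩
  have ha := norm_lt_one_of_mem (hφD hz)
  have hx : 0 < 1 - ‖φ z‖ := by linarith
  have h1 := hω _ (hφD hz) ((le_max_left _ _).trans_lt hsz)
  set n := ⌊1 / (1 - ‖φ z‖)⌋₊
  have hn : N ≤ n := by
    refine Nat.le_floor ?_
    rw [le_div_iff₀ hx]
    have h2 : 1 - 1 / ((N : ℝ) + 1) < ‖φ z‖ := (le_max_right _ _).trans_lt hsz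
    have h3 : (1 - ‖φ z‖) * (N + 1) ≤ 1 := by
      rw [← le_div_iff₀ hN1]; linarith
    nlinarith
  have h2 : ENNReal.ofReal (c n * (stdWeight β z * ‖q z * φ z ^ n‖)) ≤ ENNReal.ofReal R := by
    rw [ENNReal.ofReal_mul (hc n)]
    refine le_trans ?_ (hN n hn).le
    gcongr
    exact le_iSup₂ (f := fun z (_ : z ∈ unitDisk) =>
      ENNReal.ofReal (stdWeight β z * ‖q z * φ z ^ n‖)) z hz
  rw [ENNReal.ofReal_le_ofReal_iff hR.le, norm_mul, norm_pow] at h2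
  have hq0 : 0 ≤ stdWeight β z * ‖q z‖ := mul_nonneg (stdWeight_nonneg β hz) (norm_nonneg _)
  calc stdWeight β z * ‖q z‖ * ω (φ z) ≤ stdWeight β z * ‖q z‖ * (κ * (c n * ‖φ z‖ ^ n)) := by
        gcongr
    _ = κ * (c n * (stdWeight β z * (‖q z‖ * ‖φ z‖ ^ n))) := by ring
    _ ≤ κ * R := by gcongr

/-- Real numbers strictly above `R` approximate it from above; for `R = ∞` there is nothing to
prove. -/
lemma inv_mul_le_of_forall_lt {C : ℝ≥0} (hC : 0 < C) {E R : ℝ≥0∞}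
    (h : ∀ R' : ℝ, 0 < R' → R < ENNReal.ofReal R' → E ≤ ENNReal.ofReal (C * R')) :
    (C⁻¹ : ℝ≥0) * E ≤ R := by
  refine ENNReal.le_of_forall_pos_le_add fun ε hε hR => ?_
  have hε' : (0 : ℝ) < ε := hε
  have h0 : ENNReal.ofReal (R.toReal + ε) = R + ε := by
    rw [ENNReal.ofReal_add ENNReal.toReal_nonneg hε'.le, ENNReal.ofReal_toReal hR.ne,
      ENNReal.ofReal_coe_nnreal]
  have h1 := h (R.toReal + ε) (add_pos_of_nonneg_of_pos ENNReal.toReal_nonneg hε')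
    (by rw [h0]; exact ENNReal.lt_add_right hR.ne (by simpa using hε.ne'))
  rw [ENNReal.ofReal_mul C.coe_nonneg, ENNReal.ofReal_coe_nnreal, h0] at h1
  calc (C⁻¹ : ℝ≥0) * E ≤ (C⁻¹ : ℝ≥0) * (C * (R + ε)) := by gcongr
    _ = R + ε := by
        rw [← mul_assoc, ← ENNReal.coe_mul, inv_mul_cancel₀ hC.ne', ENNReal.coe_one, one_mul]

lemma le_mul_essentialNorm {X Y : Type*} [NormedAddCommGroup X] [NormedSpace ℂ X]
    [NormedAddCommGroup Y] [NormedSpace ℂ Y] {T : X →L[ℂ] Y} {C : ℝ≥0} (hC : 0 < C) {R : ℝ≥0∞}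
    (h : ∀ K : X →L[ℂ] Y, IsCompactOperator K → ∀ ε : ℝ, 0 < ε →
      R ≤ ENNReal.ofReal (C * (‖T + K‖ + ε))) : R ≤ C * essentialNorm T := by
  have hC0 : (C : ℝ≥0∞) ≠ 0 := by simpa using hC.ne'
  rw [← ENNReal.div_le_iff' hC0 ENNReal.coe_ne_top]
  refine le_iInf₂ fun K hK => ?_
  rw [ENNReal.div_le_iff' hC0 ENNReal.coe_ne_top]
  refine ENNReal.le_of_forall_pos_le_add fun ε hε _ => ?_
  have hε' : (0 : ℝ) < ε := hε
  have hC' : (0 : ℝ) < C := hC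
  refine (h K hK (ε / C) (div_pos hε' hC')).trans_eq ?_
  rw [mul_add, mul_div_cancel₀ _ hC'.ne', ENNReal.ofReal_add (by positivity) hε'.le,
    ENNReal.ofReal_mul C.coe_nonneg, ENNReal.ofReal_coe_nnreal, ENNReal.ofReal_coe_nnreal,
    ofReal_norm]

end Limsup

/-! ### Lower bounds by test functions, upper bounds by growth. -/

section Operator

variable {α β : ℝ} {φ g : ℂ → ℂ} (hφ : DifferentiableOn ℂ φ unitDisk)
  (hφD : Set.MapsTo φ unitDisk unitDisk) (hg : DifferentiableOn ℂ g unitDisk)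
  {T : ZygmundSpace α →L[ℂ] ZygmundSpace β}
  (hT : ∀ f : ZygmundSpace α, ∀ z ∈ unitDisk, T f z = compVolterraV φ g f z)

include hφ hφD hg hT

/-- Test at `a = φ z`: `T f = (T + K) f - K f`, and `K f` is small when `a` is near the circle. -/
lemma exists_bound_of_isNullFamily (hα : 0 < α) {f : unitDisk → ZygmundSpace α} {M : ℝ}
    (hf : ZygmundSpace.IsNullFamily toCircle f M) {K : ZygmundSpace α →L[ℂ] ZygmundSpace β}
    (hK : IsCompactOperator K) {ε : ℝ} (hε : 0 < ε) :
    ∃ s < 1, ∀ z (hz : z ∈ unitDisk), s < ‖φ z‖ →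
      stdWeight β z * ‖deriv (deriv (f ⟨φ z, hφD hz⟩)) (φ z) * symbolTwo φ g z +
        deriv (f ⟨φ z, hφD hz⟩) (φ z) * symbolOne φ g z‖ ≤ M * (‖T + K‖ + ε) := by
  have hM : 0 ≤ M := (norm_nonneg _).trans (hf.norm_le ⟨0, ZygmundSpace.zero_mem_unitDisk⟩)
  -- The margin `M * ε` for `K f` has to be positive; for `M = 0` the family is zero.
  rcases hM.eq_or_lt with hM0 | hM0
  · refine ⟨0, one_pos, fun z hz _ => ?_⟩
    have h0 : f ⟨φ z, hφD hz⟩ = 0 := norm_le_zero_iff.1 ((hf.norm_le _).trans hM0.ge)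
    have h := (T (f ⟨φ z, hφD hz⟩)).weight_mul_le_norm hz
    rw [deriv_deriv_compVolterra_apply hφ hφD hg hT _ hz] at h
    refine h.trans ?_
    rw [h0, ← hM0, map_zero, norm_zero, zero_mul]
  have h1 := (hf.tendsto_of_isCompactOperator hα hK).norm
  rw [norm_zero] at h1
  obtain ⟨s, hs, h⟩ := eventually_toCircle.1 (h1.eventually (gt_mem_nhds (mul_pos hM0 hε)))
  refine ⟨s, hs, fun z hz hsz => ?_⟩
  rw [← deriv_deriv_compVolterra_apply hφ hφD hg hT _ hz]
  refine ((T _).weight_mul_le_norm hz).trans ?_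
  set F := f ⟨φ z, hφD hz⟩
  have h2 : ‖K F‖ < M * ε := h ⟨φ z, hφD hz⟩ hsz
  have h3 : T F = (T + K) F - K F := by simp
  have h4 : ‖(T + K) F‖ ≤ ‖T + K‖ * M :=
    ((T + K).le_opNorm F).trans (mul_le_mul_of_nonneg_left (hf.norm_le _) (norm_nonneg _))
  rw [h3]
  linarith [norm_sub_le ((T + K) F) (K F)]

/-- The vanishing of `f'` at `a` removes the `w`-term; restricting to `|φ z| > 1 / 2` turns the
factor `|conj a|` into the constant `2`. -/
lemma exists_symbolTwo_le (hα : 0 < α) {f : unitDisk → ZygmundSpace α} {M : ℝ}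
    (hf : ZygmundSpace.IsNullFamily toCircle f M)
    (hf1 : ∀ a : unitDisk, deriv (f a) a = 0)
    (hf2 : ∀ a : unitDisk, deriv (deriv (f a)) a =
      conj (a : ℂ) * ((1 - ‖(a : ℂ)‖ ^ 2) ^ (-α) : ℝ))
    {K : ZygmundSpace α →L[ℂ] ZygmundSpace β} (hK : IsCompactOperator K) {ε : ℝ} (hε : 0 < ε) :
    ∃ s < 1, ∀ z ∈ unitDisk, s < ‖φ z‖ →
      stdWeight β z * ‖symbolTwo φ g z‖ * (1 - ‖φ z‖ ^ 2) ^ (-α) ≤ 2 * M * (‖T + K‖ + ε) := by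
  obtain ⟨s, hs, h⟩ := exists_bound_of_isNullFamily hφ hφD hg hT hα hf hK hε
  refine ⟨max s (1 / 2), max_lt hs (by norm_num), fun z hz hsz => ?_⟩
  have h1 := h z hz ((le_max_left _ _).trans_lt hsz)
  have h2 : 1 / 2 < ‖φ z‖ := (le_max_right _ _).trans_lt hsz
  have h0 := one_sub_norm_sq_pos (hφD hz)
  have h3 : 0 ≤ (1 - ‖φ z‖ ^ 2) ^ (-α) := Real.rpow_nonneg h0.le _
  have e1 := hf1 ⟨φ z, hφD hz⟩
  have e2 := hf2 ⟨φ z, hφD hz⟩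
  simp only at e1 e2
  rw [e1, e2, zero_mul, add_zero, norm_mul, norm_mul, RCLike.norm_conj, Complex.norm_real,
    Real.norm_of_nonneg h3] at h1
  have h4 : 0 ≤ stdWeight β z * ‖symbolTwo φ g z‖ * (1 - ‖φ z‖ ^ 2) ^ (-α) :=
    mul_nonneg (mul_nonneg (stdWeight_nonneg β hz) (norm_nonneg _)) h3
  nlinarith

/-- The test function sees both symbols; the `u`-term is subtracted with the estimate already
obtained, whence `M + A * C`. -/
lemma exists_symbolOne_le (hα : 0 < α) {f : unitDisk → ZygmundSpace α} {M A C : ℝ} (hA : 0 ≤ A)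
    (hf : ZygmundSpace.IsNullFamily toCircle f M) {ω : ℂ → ℝ}
    (hf1 : ∀ a : unitDisk, ω a ≤ ‖deriv (f a) a‖)
    (hf2 : ∀ a : unitDisk, ‖deriv (deriv (f a)) a‖ ≤ A * (1 - ‖(a : ℂ)‖ ^ 2) ^ (-α))
    {K : ZygmundSpace α →L[ℂ] ZygmundSpace β} (hK : IsCompactOperator K) {ε : ℝ} (hε : 0 < ε)
    (hu : ∃ s < 1, ∀ z ∈ unitDisk, s < ‖φ z‖ →
      stdWeight β z * ‖symbolTwo φ g z‖ * (1 - ‖φ z‖ ^ 2) ^ (-α) ≤ C * (‖T + K‖ + ε)) :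
    ∃ s < 1, ∀ z ∈ unitDisk, s < ‖φ z‖ →
      stdWeight β z * ‖symbolOne φ g z‖ * ω (φ z) ≤ (M + A * C) * (‖T + K‖ + ε) := by
  obtain ⟨s, hs, h⟩ := exists_bound_of_isNullFamily hφ hφD hg hT hα hf hK hε
  obtain ⟨s', hs', hu⟩ := hu
  refine ⟨max s s', max_lt hs hs', fun z hz hsz => ?_⟩
  have h1 := h z hz ((le_max_left _ _).trans_lt hsz)
  have h2 := hu z hz ((le_max_right _ _).trans_lt hsz)
  have h3 := hf1 ⟨φ z, hφD hz⟩
  have h4 := hf2 ⟨φ z, hφD hz⟩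
  simp only at h3 h4
  set F := f ⟨φ z, hφD hz⟩
  have hv := stdWeight_nonneg β hz
  have h5 : ‖deriv F (φ z)‖ * ‖symbolOne φ g z‖ ≤ ‖deriv (deriv F) (φ z) * symbolTwo φ g z +
      deriv F (φ z) * symbolOne φ g z‖ + ‖deriv (deriv F) (φ z)‖ * ‖symbolTwo φ g z‖ := by
    rw [← norm_mul, ← norm_mul]
    have := norm_sub_le (deriv (deriv F) (φ z) * symbolTwo φ g z +
      deriv F (φ z) * symbolOne φ g z) (deriv (deriv F) (φ z) * symbolTwo φ g z)
    rwa [add_sub_cancel_left] at this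
  calc stdWeight β z * ‖symbolOne φ g z‖ * ω (φ z)
      ≤ stdWeight β z * ‖symbolOne φ g z‖ * ‖deriv F (φ z)‖ := by gcongr
    _ = stdWeight β z * (‖deriv F (φ z)‖ * ‖symbolOne φ g z‖) := by ring
    _ ≤ stdWeight β z * (‖deriv (deriv F) (φ z) * symbolTwo φ g z +
        deriv F (φ z) * symbolOne φ g z‖ +
        A * (1 - ‖φ z‖ ^ 2) ^ (-α) * ‖symbolTwo φ g z‖) := by
        gcongr
        refine h5.trans ?_
        gcongr
    _ = stdWeight β z * ‖deriv (deriv F) (φ z) * symbolTwo φ g z +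
        deriv F (φ z) * symbolOne φ g z‖ +
        A * (stdWeight β z * ‖symbolTwo φ g z‖ * (1 - ‖φ z‖ ^ 2) ^ (-α)) := by ring
    _ ≤ M * (‖T + K‖ + ε) + A * (C * (‖T + K‖ + ε)) := by gcongr
    _ = _ := by ring

omit hφ hφD hg hT in
/-- A boundary estimate for a symbol bounds the corresponding power limsup. -/
lemma limsupPow_rpow_le (hφD : Set.MapsTo φ unitDisk unitDisk) {p : ℝ} (hp : 0 < p) {q : ℂ → ℂ}
    {B X : ℝ} (hB : ∀ z ∈ unitDisk, stdWeight β z * ‖q z‖ ≤ B) (hX : 0 ≤ X)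
    (h : ∃ s < 1, ∀ z ∈ unitDisk, s < ‖φ z‖ →
      stdWeight β z * ‖q z‖ * (1 - ‖φ z‖ ^ 2) ^ (-p) ≤ X) :
    limsupPow β (fun n => ENNReal.ofReal (((n : ℝ) + 1) ^ p)) q φ ≤
      ENNReal.ofReal (Real.exp 1 * p ^ p * 2 ^ p * X) := by
  obtain ⟨s, hs, h⟩ := h
  refine limsupPow_le (s := max s 0) (ω := fun a => (1 - ‖a‖ ^ 2) ^ (-p))
    (fun n => by positivity) (by positivity) hX (le_max_right _ _)
    (tendsto_add_one_rpow_mul_pow hp (le_max_right _ _) (max_lt hs one_pos)) hφD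
    (fun n a ha => ?_) hB fun z hz hsz => h z hz ((le_max_left _ _).trans_lt hsz)
  have ha1 := norm_lt_one_of_mem ha
  calc ((n : ℝ) + 1) ^ p * ‖a‖ ^ n ≤ Real.exp 1 * p ^ p * (1 - ‖a‖) ^ (-p) :=
        add_one_rpow_mul_pow_le hp (norm_nonneg a) ha1 n
    _ ≤ Real.exp 1 * p ^ p * (2 ^ p * (1 - ‖a‖ ^ 2) ^ (-p)) := by
        gcongr
        exact one_sub_rpow_neg_le_sq hp.le (norm_nonneg a) ha1
    _ = _ := by ring

omit hφ hφD hg hT in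
lemma limsupPow_log_le (hφD : Set.MapsTo φ unitDisk unitDisk) {q : ℂ → ℂ}
    {B X : ℝ} (hB : ∀ z ∈ unitDisk, stdWeight β z * ‖q z‖ ≤ B) (hX : 0 ≤ X)
    (h : ∃ s < 1, ∀ z ∈ unitDisk, s < ‖φ z‖ →
      stdWeight β z * ‖q z‖ * (1 - Real.log (1 - ‖φ z‖ ^ 2)) ≤ X) :
    limsupPow β (fun n => ENNReal.ofReal (Real.log n)) q φ ≤ ENNReal.ofReal (2 * X) := by
  obtain ⟨s, hs, h⟩ := h
  have hs' : max s 0 < 1 := max_lt hs one_pos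
  refine limsupPow_le (s := max s 0) (ω := fun a => 1 - Real.log (1 - ‖a‖ ^ 2))
    (fun n => Real.log_natCast_nonneg n) zero_le_two hX (le_max_right _ _)
    ?_ hφD (fun n a ha => ?_) hB fun z hz hsz => h z hz ((le_max_left _ _).trans_lt hsz)
  · have ht := tendsto_add_one_rpow_mul_pow one_pos (le_max_right s 0) hs'
    refine squeeze_zero (fun n => mul_nonneg (Real.log_natCast_nonneg n) (by positivity))
      (fun n => ?_) ht
    rw [Real.rpow_one]
    have : Real.log n ≤ n + 1 := by
      linarith [Real.log_le_self (Nat.cast_nonneg (α := ℝ) n)]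
    gcongr
  · have ha1 := norm_lt_one_of_mem ha
    have ha0 := norm_nonneg a
    refine (log_nat_mul_pow_le ha0 ha1 n).trans ?_
    -- Replacing `1 - |a|` by `1 - |a|²` costs `log 2 ≤ 1`, absorbed by the factor `2` because `1 -
    -- log (1 - |a|²) ≥ 1`.
    have h1 : Real.log (1 - ‖a‖ ^ 2) ≤ Real.log 2 + Real.log (1 - ‖a‖) := by
      rw [← Real.log_mul two_ne_zero (by linarith)]
      exact Real.log_le_log (one_sub_norm_sq_pos ha) (by nlinarith)
    have h2 : Real.log 2 ≤ 1 := by linarith [Real.log_two_lt_d9]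
    have h3 : Real.log (1 - ‖a‖ ^ 2) ≤ 0 :=
      Real.log_nonpos (one_sub_norm_sq_pos ha).le (by nlinarith)
    linarith

omit hφ hφD hg hT in
lemma exists_rpow_bound_of_limsupPow_lt (hφD : Set.MapsTo φ unitDisk unitDisk) {p : ℝ}
    (hp : 0 < p) {q : ℂ → ℂ} {R : ℝ} (hR : 0 < R)
    (h : limsupPow β (fun n => ENNReal.ofReal (((n : ℝ) + 1) ^ p)) q φ < ENNReal.ofReal R) :
    ∃ s < 1, ∀ z ∈ unitDisk, s < ‖φ z‖ →
      stdWeight β z * ‖q z‖ * (1 - ‖φ z‖) ^ (-p) ≤ Real.exp 2 * R :=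
  exists_boundary_bound_of_limsupPow_lt (s₀ := 1 / 2) (ω := fun a => (1 - ‖a‖) ^ (-p))
    (fun n => by positivity) hR (by positivity) (by norm_num) hφD
    (fun a ha ha2 => one_sub_rpow_neg_le hp ha2.le (norm_lt_one_of_mem ha)) h

omit hφ hφD hg hT in
lemma exists_log_bound_of_limsupPow_lt (hφD : Set.MapsTo φ unitDisk unitDisk) {q : ℂ → ℂ}
    {R : ℝ} (hR : 0 < R)
    (h : limsupPow β (fun n => ENNReal.ofReal (Real.log n)) q φ < ENNReal.ofReal R) :
    ∃ s < 1, ∀ z ∈ unitDisk, s < ‖φ z‖ →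
      stdWeight β z * ‖q z‖ * -Real.log (1 - ‖φ z‖) ≤ 2 * Real.exp 2 * R :=
  exists_boundary_bound_of_limsupPow_lt (s₀ := 3 / 4) (ω := fun a => -Real.log (1 - ‖a‖))
    (fun n => Real.log_natCast_nonneg n) hR (by positivity) (by norm_num) hφD
    (fun a ha ha2 => neg_log_one_sub_le ha2.le (norm_lt_one_of_mem ha)) h

omit hφ hφD hg hT in
lemma exists_symbolTwo_le_stdWeight (hφD : Set.MapsTo φ unitDisk unitDisk) (hα : 0 < α) {R : ℝ}
    (hR : 0 < R)
    (h : limsupPow β (fun n => ENNReal.ofReal (((n : ℝ) + 1) ^ α)) (symbolTwo φ g) φ <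
      ENNReal.ofReal R) :
    ∃ s < 1, ∀ z ∈ unitDisk, s < ‖φ z‖ →
      stdWeight β z * ‖symbolTwo φ g z‖ ≤ Real.exp 2 * R * stdWeight α (φ z) := by
  obtain ⟨s, hs, h⟩ := exists_rpow_bound_of_limsupPow_lt hφD hα hR h
  refine ⟨s, hs, fun z hz hsz => ?_⟩
  have h1 := h z hz hsz
  have h0 : 0 < 1 - ‖φ z‖ := by linarith [norm_lt_one_of_mem (hφD hz)]
  rw [Real.rpow_neg h0.le, ← div_eq_mul_inv, div_le_iff₀ (Real.rpow_pos_of_pos h0 _)] at h1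
  exact h1.trans (mul_le_mul_of_nonneg_left (one_sub_rpow_le_stdWeight hα (hφD hz))
    (by positivity))

lemma essentialNorm_le_of_lt_one (hα : 0 < α) (hα1 : α < 1) {R : ℝ} (hR : 0 < R)
    (h : limsupPow β (fun n => ENNReal.ofReal (((n : ℝ) + 1) ^ α)) (symbolTwo φ g) φ <
      ENNReal.ofReal R) :
    essentialNorm T ≤ ENNReal.ofReal ((3 * Real.exp 2 + 1) * R) := by
  obtain ⟨s₁, hs₁, hu⟩ := exists_symbolTwo_le_stdWeight hφD hα hR h
  obtain ⟨W, hW0, hW⟩ := exists_symbolOne_bound hφ hφD hg hT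
  have hlim : Filter.Tendsto (fun s : ℝ => W * (3 * ((1 - s) ^ (1 - α) / (1 - α))))
      (nhdsWithin 1 (Set.Iio 1)) (nhds 0) := by
    have h1 : Filter.Tendsto (fun s : ℝ => 1 - s) (nhdsWithin 1 (Set.Iio 1)) (nhds 0) := by
      have : Filter.Tendsto (fun s : ℝ => 1 - s) (nhds 1) (nhds (1 - 1)) :=
        (continuous_const.sub continuous_id).tendsto 1
      rw [sub_self] at this
      exact this.mono_left nhdsWithin_le_nhds
    have h2 := (((h1.rpow_const (p := 1 - α) (Or.inr (by linarith))).div_const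
      (1 - α)).const_mul 3).const_mul W
    rwa [Real.zero_rpow (by linarith), zero_div, mul_zero, mul_zero] at h2
  -- `s` is so close to `1` that the variation of `F'` beyond it costs less than `R / 2`; the size
  -- of `F'` on `|ζ| = s` costs at most another `R / 2` by the choice of `δ` below.
  obtain ⟨s, ⟨hsR, hss⟩, hs1⟩ := ((hlim.eventually (gt_mem_nhds (half_pos hR))).and
    ((lt_mem_nhds (max_lt hs₁ one_pos)).filter_mono nhdsWithin_le_nhds)).and
      self_mem_nhdsWithin |>.exists
  have hs1' : s < 1 := hs1
  have hs0 : 0 ≤ s := ((le_max_right _ _).trans_lt hss).le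
  have hs₁s : s₁ < s := (le_max_left _ _).trans_lt hss
  have hδ : 0 < R / (2 * (W + 1)) := by positivity
  refine (essentialNorm_le_of_boundary_bound hφ hφD hg hT hα (s := s) (B₁ := Real.exp 2 * R)
    (B₂ := R) hs1' hδ (by positivity) hR.le
    (fun z hz hsz => hu z hz (hs₁s.trans hsz)) ?_).trans_eq (by ring_nf)
  intro F M hM hF0 hF2 hFs z hz hsz
  obtain ⟨ζ, hζ, h2⟩ := exists_norm_le_add_of_weight_lt_one hα hα1 F.differentiableOn_deriv
    (by positivity : 0 ≤ 3 * M) hF2 hs0 (hφD hz) hsz.le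
  have h3 := hFs ζ hζ.le
  have h4 : W * (R / (2 * (W + 1))) ≤ R / 2 := by
    rw [mul_div_assoc', div_le_div_iff₀ (by positivity) two_pos]
    nlinarith
  have h5 : 0 ≤ (1 - s) ^ (1 - α) / (1 - α) :=
    div_nonneg (Real.rpow_nonneg (by linarith) _) (by linarith)
  calc stdWeight β z * ‖symbolOne φ g z‖ * ‖deriv F (φ z)‖
      ≤ W * (R / (2 * (W + 1)) * M + 3 * M * ((1 - s) ^ (1 - α) / (1 - α))) := by
        refine mul_le_mul (hW z hz) (h2.trans (add_le_add h3 le_rfl)) (norm_nonneg _) hW0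
    _ = (W * (R / (2 * (W + 1))) + W * (3 * ((1 - s) ^ (1 - α) / (1 - α)))) * M := by ring
    _ ≤ R * M := by gcongr; linarith

omit hφ hφD hg hT in
lemma mul_norm_le_of_growth {v x y ω M X : ℝ} (hv : 0 ≤ v) (hy : y ≤ M * ω) (hM : 0 ≤ M)
    (hx : 0 ≤ x) (h : v * x * ω ≤ X) : v * x * y ≤ X * M := by
  calc v * x * y ≤ v * x * (M * ω) := by gcongr
    _ = v * x * ω * M := by ring
    _ ≤ X * M := by gcongr

/-- The growth `(1 - |ζ|)^(1 - α)` of `F'` is exactly the rate against which the second limsup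
measures `w`. -/
lemma essentialNorm_le_of_one_lt (hα1 : 1 < α) {R : ℝ} (hR : 0 < R)
    (h : limsupPow β (fun n => ENNReal.ofReal (((n : ℝ) + 1) ^ α)) (symbolTwo φ g) φ <
      ENNReal.ofReal R)
    (h' : limsupPow β (fun n => ENNReal.ofReal (((n : ℝ) + 1) ^ (α - 1))) (symbolOne φ g) φ <
      ENNReal.ofReal R) :
    essentialNorm T ≤ ENNReal.ofReal ((3 * Real.exp 2 + 3 * Real.exp 2 / (α - 1)) * R) := by
  have hα : 0 < α := one_pos.trans hα1
  have hα' : 0 < α - 1 := by linarith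
  obtain ⟨s₁, hs₁, hu⟩ := exists_symbolTwo_le_stdWeight hφD hα hR h
  obtain ⟨s₂, hs₂, hw⟩ := exists_rpow_bound_of_limsupPow_lt hφD hα' hR h'
  refine (essentialNorm_le_of_boundary_bound hφ hφD hg hT hα (s := max s₁ s₂)
    (B₁ := Real.exp 2 * R) (B₂ := 3 / (α - 1) * (Real.exp 2 * R)) (max_lt hs₁ hs₂) one_pos
    (by positivity) (by positivity)
    (fun z hz hsz => hu z hz ((le_max_left _ _).trans_lt hsz)) ?_).trans_eq (by ring_nf)
  intro F M hM hF0 hF2 _ z hz hsz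
  have h1 := norm_le_of_one_lt_weight hα1 F.differentiableOn_deriv hF0
    (by positivity : 0 ≤ 3 * M) hF2 (hφD hz)
  have h2 := hw z hz ((le_max_right _ _).trans_lt hsz)
  rw [neg_sub] at h2
  have h3 := mul_norm_le_of_growth (M := 3 * M / (α - 1)) (stdWeight_nonneg β hz)
    (h1.trans_eq (by ring)) (by positivity) (norm_nonneg (symbolOne φ g z)) h2
  exact h3.trans_eq (by ring)

end Operator

lemma essentialNorm_le_of_eq_one {β : ℝ} {φ g : ℂ → ℂ} (hφ : DifferentiableOn ℂ φ unitDisk)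
    (hφD : Set.MapsTo φ unitDisk unitDisk) (hg : DifferentiableOn ℂ g unitDisk)
    {T : ZygmundSpace 1 →L[ℂ] ZygmundSpace β}
    (hT : ∀ f : ZygmundSpace 1, ∀ z ∈ unitDisk, T f z = compVolterraV φ g f z)
    {R : ℝ} (hR : 0 < R)
    (h : limsupPow β (fun n => ENNReal.ofReal (((n : ℝ) + 1) ^ (1 : ℝ))) (symbolTwo φ g) φ <
      ENNReal.ofReal R)
    (h' : limsupPow β (fun n => ENNReal.ofReal (Real.log n)) (symbolOne φ g) φ <
      ENNReal.ofReal R) :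
    essentialNorm T ≤ ENNReal.ofReal (9 * Real.exp 2 * R) := by
  obtain ⟨s₁, hs₁, hu⟩ := exists_symbolTwo_le_stdWeight hφD one_pos hR h
  obtain ⟨s₂, hs₂, hw⟩ := exists_log_bound_of_limsupPow_lt hφD hR h'
  refine (essentialNorm_le_of_boundary_bound hφ hφD hg hT one_pos (s := max s₁ s₂)
    (B₁ := Real.exp 2 * R) (B₂ := 3 * (2 * Real.exp 2 * R)) (max_lt hs₁ hs₂) one_pos
    (by positivity) (by positivity)
    (fun z hz hsz => hu z hz ((le_max_left _ _).trans_lt hsz)) ?_).trans_eq (by ring_nf)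
  intro F M hM hF0 hF2 _ z hz hsz
  have h1 := norm_le_of_weight_one F.differentiableOn_deriv hF0 hF2 (hφD hz)
  have h2 := hw z hz ((le_max_right _ _).trans_lt hsz)
  have h3 := mul_norm_le_of_growth (M := 3 * M) (stdWeight_nonneg β hz)
    h1 (by positivity) (norm_nonneg (symbolOne φ g z)) h2
  exact h3.trans_eq (by ring)

/-! ### Constants independent of the symbols, and the three cases. -/

namespace ZygmundSpace

/-- Subtract the power families with consecutive exponents `m = ⌈α⌉` and `m + 1`: the values of `f'`
at `a` cancel and the coefficients of `f''` differ by `1`. -/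
lemma exists_power_family_deriv_eq_zero {α : ℝ} (hα : 0 < α) :
    ∃ (f : unitDisk → ZygmundSpace α) (M : ℝ), 0 < M ∧ IsNullFamily toCircle f M ∧
      (∀ a : unitDisk, deriv (f a) a = 0) ∧
      ∀ a : unitDisk, deriv (deriv (f a)) a =
        conj (a : ℂ) * ((1 - ‖(a : ℂ)‖ ^ 2) ^ (-α) : ℝ) := by
  have hm : α < (⌈α⌉₊ : ℝ) + 1 := (Nat.le_ceil α).trans_lt (lt_add_one _)
  obtain ⟨f, hf, hfd⟩ := exists_power_family hα hm
  obtain ⟨f', hf', hfd'⟩ := exists_power_family (m := ⌈α⌉₊ + 1) hα (by push_cast; linarith)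
  refine ⟨_, _, ?_, hf'.sub hf, fun a => ?_, fun a => ?_⟩
  · positivity
  · rw [deriv_sub _ _ a.2, Pi.sub_apply, (hfd a).1, (hfd' a).1, sub_self]
  · rw [deriv_deriv_sub _ _ a.2, Pi.sub_apply, (hfd a).2, (hfd' a).2]
    push_cast
    ring

end ZygmundSpace

/-- `T : 𝒵^α → 𝒵^β` is the operator `C_φ V_g` for analytic `φ : D → D` and `g`. -/
structure IsCompVolterra {α β : ℝ} (φ g : ℂ → ℂ) (T : ZygmundSpace α →L[ℂ] ZygmundSpace β) :
    Prop where
  differentiableOn_left : DifferentiableOn ℂ φ unitDisk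
  mapsTo : Set.MapsTo φ unitDisk unitDisk
  differentiableOn_right : DifferentiableOn ℂ g unitDisk
  apply_eq : ∀ f : ZygmundSpace α, ∀ z ∈ unitDisk, T f z = compVolterraV φ g f z

open ZygmundSpace

/-- The test family, hence `C`, is fixed before `φ` and `g`. The pointwise estimate is kept beside
the limsup because the bounds for `w` need it. -/
lemma exists_limsupPow_symbolTwo_le {α : ℝ} (hα : 0 < α) (β : ℝ) :
    ∃ C : ℝ, 0 < C ∧ ∀ (φ g : ℂ → ℂ) (T K : ZygmundSpace α →L[ℂ] ZygmundSpace β),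
      IsCompVolterra φ g T → IsCompactOperator K → ∀ ε : ℝ, 0 < ε →
        limsupPow β (fun n => ENNReal.ofReal (((n : ℝ) + 1) ^ α)) (symbolTwo φ g) φ ≤
          ENNReal.ofReal (C * (‖T + K‖ + ε)) ∧
        ∃ s < 1, ∀ z ∈ unitDisk, s < ‖φ z‖ →
          stdWeight β z * ‖symbolTwo φ g z‖ * (1 - ‖φ z‖ ^ 2) ^ (-α) ≤ C * (‖T + K‖ + ε) := by
  obtain ⟨f, M, hM, hf, hf1, hf2⟩ := exists_power_family_deriv_eq_zero hα
  set A := Real.exp 1 * α ^ α * 2 ^ α with hA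
  have hA0 : 0 < A := by positivity
  -- `A + 1` dominates both `A`, needed for the limsup, and `1`, needed for the pointwise estimate.
  refine ⟨(A + 1) * (2 * M), by positivity, fun φ g T K hT hK ε hε => ?_⟩
  obtain ⟨hφ, hφD, hg, hT⟩ := hT
  have hb := exists_symbolTwo_le hφ hφD hg hT hα hf hf1 hf2 hK hε
  obtain ⟨B, -, hB⟩ := exists_symbolTwo_bound hφ hφD hg hT hα
  have hX : 0 ≤ 2 * M * (‖T + K‖ + ε) := by positivity
  constructor
  · refine (limsupPow_rpow_le hφD hα hB hX hb).trans (ENNReal.ofReal_le_ofReal ?_)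
    rw [← hA, mul_assoc (A + 1)]
    exact mul_le_mul_of_nonneg_right (by linarith) hX
  · obtain ⟨s, hs, h⟩ := hb
    refine ⟨s, hs, fun z hz hsz => (h z hz hsz).trans ?_⟩
    rw [mul_assoc (A + 1)]
    exact le_mul_of_one_le_left hX (by linarith)

lemma exists_limsupPow_symbolOne_rpow_le {α : ℝ} (hα1 : 1 < α) (β : ℝ) :
    ∃ C : ℝ, 0 < C ∧ ∀ (φ g : ℂ → ℂ) (T K : ZygmundSpace α →L[ℂ] ZygmundSpace β),
      IsCompVolterra φ g T → IsCompactOperator K → ∀ ε : ℝ, 0 < ε →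
        limsupPow β (fun n => ENNReal.ofReal (((n : ℝ) + 1) ^ (α - 1))) (symbolOne φ g) φ ≤
          ENNReal.ofReal (C * (‖T + K‖ + ε)) := by
  have hα : 0 < α := one_pos.trans hα1
  have hp : 0 < α - 1 := by linarith
  obtain ⟨C, hC, hu⟩ := exists_limsupPow_symbolTwo_le hα β
  have hm : α < (⌈α⌉₊ : ℝ) + 1 := (Nat.le_ceil α).trans_lt (lt_add_one _)
  obtain ⟨f, hf, hfd⟩ := exists_power_family hα hm
  set m := ⌈α⌉₊
  set M : ℝ := 1 + m * 2 ^ (m + 1)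
  have hM : 0 < M := by positivity
  refine ⟨Real.exp 1 * (α - 1) ^ (α - 1) * 2 ^ (α - 1) * (M + m * C), by positivity,
    fun φ g T K hT hK ε hε => ?_⟩
  have hb := (hu φ g T K hT hK ε hε).2
  obtain ⟨hφ, hφD, hg, hT⟩ := hT
  obtain ⟨B, -, hB⟩ := exists_symbolOne_bound hφ hφD hg hT
  -- A single power family suffices here, since `f'(a) = (1 - |a|²)^(1 - α)` already has the maximal
  -- growth for `α > 1`.
  have hw := exists_symbolOne_le hφ hφD hg hT hα (A := m) (Nat.cast_nonneg m) hf
    (ω := fun a => (1 - ‖a‖ ^ 2) ^ (-(α - 1)))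
    (fun a => by
      rw [(hfd a).1, Complex.norm_real, neg_sub]
      exact le_abs_self _)
    (fun a => by
      have h0 : 0 ≤ (1 - ‖(a : ℂ)‖ ^ 2) ^ (-α) := Real.rpow_nonneg (one_sub_norm_sq_pos a.2).le _
      rw [(hfd a).2, norm_mul, norm_mul, Complex.norm_natCast, RCLike.norm_conj,
        Complex.norm_real, Real.norm_of_nonneg h0]
      exact mul_le_mul_of_nonneg_right (mul_le_of_le_one_right (Nat.cast_nonneg m)
        (norm_lt_one_of_mem a.2).le) h0)
    hK hε hb
  rw [mul_assoc _ (M + m * C)]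
  exact limsupPow_rpow_le hφD hp hB (by positivity) hw

lemma exists_limsupPow_symbolOne_log_le (β : ℝ) :
    ∃ C : ℝ, 0 < C ∧ ∀ (φ g : ℂ → ℂ) (T K : ZygmundSpace 1 →L[ℂ] ZygmundSpace β),
      IsCompVolterra φ g T → IsCompactOperator K → ∀ ε : ℝ, 0 < ε →
        limsupPow β (fun n => ENNReal.ofReal (Real.log n)) (symbolOne φ g) φ ≤
          ENNReal.ofReal (C * (‖T + K‖ + ε)) := by
  obtain ⟨C, hC, hu⟩ := exists_limsupPow_symbolTwo_le one_pos β
  obtain ⟨f, hf, hfd⟩ := exists_log_family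
  refine ⟨2 * (1 + 48 + 2 * C), by positivity, fun φ g T K hT hK ε hε => ?_⟩
  have hb := (hu φ g T K hT hK ε hε).2
  obtain ⟨hφ, hφD, hg, hT⟩ := hT
  obtain ⟨B, -, hB⟩ := exists_symbolOne_bound hφ hφD hg hT
  have hw := exists_symbolOne_le hφ hφD hg hT one_pos (A := 2) zero_le_two hf
    (ω := fun a => 1 - Real.log (1 - ‖a‖ ^ 2))
    (fun a => by
      rw [(hfd a).1, Complex.norm_real]
      exact le_abs_self _)
    (fun a => by
      have h0 : 0 ≤ (1 - ‖(a : ℂ)‖ ^ 2)⁻¹ := inv_nonneg.2 (one_sub_norm_sq_pos a.2).le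
      rw [(hfd a).2, norm_mul, norm_mul, Complex.norm_ofNat, RCLike.norm_conj,
        Complex.norm_real, Real.norm_of_nonneg h0, Real.rpow_neg_one]
      exact mul_le_mul_of_nonneg_right (mul_le_of_le_one_right zero_le_two
        (norm_lt_one_of_mem a.2).le) h0)
    hK hε hb
  rw [mul_assoc 2]
  exact limsupPow_log_le hφD hB (by positivity) hw

theorem exists_comparable_of_lt_one {α : ℝ} (hα : 0 < α) (hα1 : α < 1) (β : ℝ) :
    ∃ C₁ C₂ : ℝ≥0, 0 < C₁ ∧ 0 < C₂ ∧ ∀ (φ g : ℂ → ℂ)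
      (T : ZygmundSpace α →L[ℂ] ZygmundSpace β), IsCompVolterra φ g T →
        ComparableWith C₁ C₂ (essentialNorm T)
          (limsupPow β (fun n => ENNReal.ofReal (((n : ℝ) + 1) ^ α)) (symbolTwo φ g) φ) := by
  obtain ⟨C, hC, hu⟩ := exists_limsupPow_symbolTwo_le hα β
  have hD : (0 : ℝ) < 3 * Real.exp 2 + 1 := by positivity
  refine ⟨(Real.toNNReal (3 * Real.exp 2 + 1))⁻¹, C.toNNReal, inv_pos.2 (Real.toNNReal_pos.2 hD),
    Real.toNNReal_pos.2 hC, fun φ g T hT => ⟨?_, ?_⟩⟩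
  · refine inv_mul_le_of_forall_lt (Real.toNNReal_pos.2 hD) fun R hR h => ?_
    rw [Real.coe_toNNReal _ hD.le]
    exact essentialNorm_le_of_lt_one hT.1 hT.2 hT.3 hT.4 hα hα1 hR h
  · refine le_mul_essentialNorm (Real.toNNReal_pos.2 hC) fun K hK ε hε => ?_
    rw [Real.coe_toNNReal _ hC.le]
    exact (hu φ g T K hT hK ε hε).1

lemma max_le_ofReal_add_mul {A B : ℝ≥0∞} {C D x : ℝ} (hC : 0 ≤ C) (hD : 0 ≤ D) (hx : 0 ≤ x)
    (hA : A ≤ ENNReal.ofReal (C * x)) (hB : B ≤ ENNReal.ofReal (D * x)) :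
    max A B ≤ ENNReal.ofReal ((C + D) * x) :=
  max_le
    (hA.trans (ENNReal.ofReal_le_ofReal (mul_le_mul_of_nonneg_right (by linarith) hx)))
    (hB.trans (ENNReal.ofReal_le_ofReal (mul_le_mul_of_nonneg_right (by linarith) hx)))

theorem exists_comparable_of_eq_one (β : ℝ) :
    ∃ C₁ C₂ : ℝ≥0, 0 < C₁ ∧ 0 < C₂ ∧ ∀ (φ g : ℂ → ℂ)
      (T : ZygmundSpace 1 →L[ℂ] ZygmundSpace β), IsCompVolterra φ g T →
        ComparableWith C₁ C₂ (essentialNorm T)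
          (max
            (limsupPow β (fun n => ENNReal.ofReal ((n : ℝ) + 1)) (symbolTwo φ g) φ)
            (limsupPow β (fun n => ENNReal.ofReal (Real.log n)) (symbolOne φ g) φ)) := by
  obtain ⟨C, hC, hu⟩ := exists_limsupPow_symbolTwo_le one_pos β
  obtain ⟨C', hC', hw⟩ := exists_limsupPow_symbolOne_log_le β
  have hD : (0 : ℝ) < 9 * Real.exp 2 := by positivity
  have hE : 0 < C + C' := by positivity
  refine ⟨(Real.toNNReal (9 * Real.exp 2))⁻¹, (C + C').toNNReal,
    inv_pos.2 (Real.toNNReal_pos.2 hD), Real.toNNReal_pos.2 hE, fun φ g T hT => ?_⟩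
  have e : (fun n : ℕ => ENNReal.ofReal ((n : ℝ) + 1)) =
      fun n : ℕ => ENNReal.ofReal (((n : ℝ) + 1) ^ (1 : ℝ)) := by
    simp only [Real.rpow_one]
  rw [e]
  constructor
  · refine inv_mul_le_of_forall_lt (Real.toNNReal_pos.2 hD) fun R hR h => ?_
    rw [Real.coe_toNNReal _ hD.le]
    exact essentialNorm_le_of_eq_one hT.1 hT.2 hT.3 hT.4 hR ((le_max_left _ _).trans_lt h)
      ((le_max_right _ _).trans_lt h)
  · refine le_mul_essentialNorm (Real.toNNReal_pos.2 hE) fun K hK ε hε => ?_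
    rw [Real.coe_toNNReal _ hE.le]
    exact max_le_ofReal_add_mul hC.le hC'.le (by positivity) (hu φ g T K hT hK ε hε).1
      (hw φ g T K hT hK ε hε)

theorem exists_comparable_of_one_lt {α : ℝ} (hα1 : 1 < α) (β : ℝ) :
    ∃ C₁ C₂ : ℝ≥0, 0 < C₁ ∧ 0 < C₂ ∧ ∀ (φ g : ℂ → ℂ)
      (T : ZygmundSpace α →L[ℂ] ZygmundSpace β), IsCompVolterra φ g T →
        ComparableWith C₁ C₂ (essentialNorm T)
          (max
            (limsupPow β (fun n => ENNReal.ofReal (((n : ℝ) + 1) ^ α)) (symbolTwo φ g) φ)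
            (limsupPow β (fun n => ENNReal.ofReal (((n : ℝ) + 1) ^ (α - 1))) (symbolOne φ g)
              φ)) := by
  have hα : 0 < α := one_pos.trans hα1
  have hp : 0 < α - 1 := by linarith
  obtain ⟨C, hC, hu⟩ := exists_limsupPow_symbolTwo_le hα β
  obtain ⟨C', hC', hw⟩ := exists_limsupPow_symbolOne_rpow_le hα1 β
  have hD : (0 : ℝ) < 3 * Real.exp 2 + 3 * Real.exp 2 / (α - 1) := by positivity
  have hE : 0 < C + C' := by positivity
  refine ⟨(Real.toNNReal (3 * Real.exp 2 + 3 * Real.exp 2 / (α - 1)))⁻¹, (C + C').toNNReal,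
    inv_pos.2 (Real.toNNReal_pos.2 hD), Real.toNNReal_pos.2 hE, fun φ g T hT => ⟨?_, ?_⟩⟩
  · refine inv_mul_le_of_forall_lt (Real.toNNReal_pos.2 hD) fun R hR h => ?_
    rw [Real.coe_toNNReal _ hD.le]
    exact essentialNorm_le_of_one_lt hT.1 hT.2 hT.3 hT.4 hα1 hR ((le_max_left _ _).trans_lt h)
      ((le_max_right _ _).trans_lt h)
  · refine le_mul_essentialNorm (Real.toNNReal_pos.2 hE) fun K hK ε hε => ?_
    rw [Real.coe_toNNReal _ hE.le]
    exact max_le_ofReal_add_mul hC.le hC'.le (by positivity) (hu φ g T K hT hK ε hε).1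
      (hw φ g T K hT hK ε hε)

end

theorem theorem3p3 (α β : ℝ) (hα : 0 < α) (hβ : 0 < β) :
    ∃ C₁ C₂ : ℝ≥0, 0 < C₁ ∧ 0 < C₂ ∧
      ∀ φ g : ℂ → ℂ, DifferentiableOn ℂ φ unitDisk → Set.MapsTo φ unitDisk unitDisk →
        DifferentiableOn ℂ g unitDisk →
      ∀ T : ZygmundSpace α →L[ℂ] ZygmundSpace β,
        (∀ f : ZygmundSpace α, ∀ z ∈ unitDisk, T f z = compVolterraV φ g f z) →
        (α < 1 →
          ComparableWith C₁ C₂ (essentialNorm T)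
            (limsupPow β (fun n => ENNReal.ofReal (((n : ℝ) + 1) ^ α))
              (fun z => g (φ z) * deriv φ z ^ 2) φ)) ∧
        (α = 1 →
          ComparableWith C₁ C₂ (essentialNorm T)
            (max
              (limsupPow β (fun n => ENNReal.ofReal ((n : ℝ) + 1))
                (fun z => g (φ z) * deriv φ z ^ 2) φ)
              (limsupPow β (fun n => ENNReal.ofReal (Real.log n))
                (fun z => deriv g (φ z) * deriv φ z ^ 2 + g (φ z) * deriv (deriv φ) z) φ))) ∧
        (1 < α →
          ComparableWith C₁ C₂ (essentialNorm T)
            (max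
              (limsupPow β (fun n => ENNReal.ofReal (((n : ℝ) + 1) ^ α))
                (fun z => g (φ z) * deriv φ z ^ 2) φ)
              (limsupPow β (fun n => ENNReal.ofReal (((n : ℝ) + 1) ^ (α - 1)))
                (fun z => deriv g (φ z) * deriv φ z ^ 2 + g (φ z) * deriv (deriv φ) z) φ))) := by
  rcases lt_trichotomy α 1 with h | h | h
  · obtain ⟨C₁, C₂, h₁, h₂, hC⟩ := exists_comparable_of_lt_one hα h β
    refine ⟨C₁, C₂, h₁, h₂, fun φ g hφ hφD hg T hT => ⟨fun _ => ?_, fun h' => ?_, fun h' => ?_⟩⟩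
    · exact hC φ g T ⟨hφ, hφD, hg, hT⟩
    · exact absurd h' h.ne
    · exact absurd h' h.not_gt
  · subst h
    obtain ⟨C₁, C₂, h₁, h₂, hC⟩ := exists_comparable_of_eq_one β
    refine ⟨C₁, C₂, h₁, h₂, fun φ g hφ hφD hg T hT => ⟨fun h' => ?_, fun _ => ?_, fun h' => ?_⟩⟩
    · exact absurd h' (lt_irrefl _)
    · exact hC φ g T ⟨hφ, hφD, hg, hT⟩
    · exact absurd h' (lt_irrefl _)
  · obtain ⟨C₁, C₂, h₁, h₂, hC⟩ := exists_comparable_of_one_lt h β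
    refine ⟨C₁, C₂, h₁, h₂, fun φ g hφ hφD hg T hT => ⟨fun h' => ?_, fun h' => ?_, fun _ => ?_⟩⟩
    · exact absurd h' h.not_gt
    · exact absurd h' h.ne'
    · exact hC φ g T ⟨hφ, hφD, hg, hT⟩
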